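/- \textbf{Setting.} Let $\Omega=\mathrm{BUC}(\mathbb R)$ be the space of bounded uniformly continuous functions $V:\mathbb R\to\mathbb R$, with the $\sigma$-algebra $\mathcal F$ generated by the evaluations $V\mapsto V(x)$, $x\in\mathbb R$, and the translations $(T_yV)(x)=V(x+y)$. Let $\mathbb P$ be a probability measure on $(\Omega,\mathcal F)$ and $H:\mathbb R\to\mathbb R$. For $p\in\mathbb R$, the pair $(H,V)$ is called \emph{regularly homogenizable at $p$} if (a) there is $\overline m>0$ with $\operatorname{ess\,sup}_{\mathbb R}V=0$ and $\operatorname{ess\,sup}_{\mathbb R}(-V)=\overline m$ $\mathbb P$-almost surely; $\mathbb P[E]=\mathbb P[T_yE]$ for all $E\in\mathcal F$, $y\in\mathbb R$; and $\mathbb P[\bigcap_{z\in\mathbb R}T_zE]\in\{0,1\}$ for all $E\in\mathcal F$; (b) $H$ is continuous and $H(p')\to+\infty$ as $|p'|\to\infty$; (c) there is a number $\overline H(p)\in\mathbb R$ such that, for every $R>0$, $$\mathbb P\Big[\limsup_{\lambda\to0^+}\ \max_{|y|\le R/\lambda}\big|\lambda v_\lambda(y,p)+\overline H(p)\big|=0\Big]=1,$$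 where $v_\lambda(\cdot,p)$, $\lambda>0$, is the unique continuous bounded viscosity solution of $\lambda v_\lambda+H(p+v_\lambda')+V=0$ in $\mathbb R$. (The number $\overline H(p)$ is then unique.) \textbf{Assumptions.} (H1) $H:\mathbb R\to[0,\infty)$ is Lipschitz continuous, $\min_{\mathbb R}H=H(0)=0$, and $H(p)\to+\infty$ as $|p|\to\infty$. (H2) There are $L\ge0$ and $p_1>p_2>\dots>p_{2L+1}=0$ such that $H$ is strictly increasing on $[p_1,\infty)$ and on $[p_{2k+1},p_{2k}]$, and strictly decreasing on $[p_{2k},p_{2k-1}]$, for $1\le k\le L$, and $H(p_1),\dots,H(p_{2L})$ are distinct positive numbers. (H3) There are $\tilde L\ge0$ and $\tilde p_1<\tilde p_2<\dots<\tilde p_{2\tilde L+1}=0$ such that $H$ is strictly decreasing on $(-\infty,\tilde p_1]$ and on $[\tilde p_{2k},\tilde p_{2k+1}]$, and strictly increasing on $[\tilde p_{2k-1},\tilde p_{2k}]$, for $1\le k\le\tilde L$, and $H(\tilde p_1),\dots,H(\tilde p_{2\tilde L})$ are distinct positive numbers. (H4) $\mathbb P$-almost surely, $V\in C^\infty(\mathbb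 R)$ and no level set of $V$ has a cluster point. \textbf{Lemma.} Assume (H1)--(H4), and suppose that $(H,V)$ is regularly homogenizable at $q\in\mathbb R$ and $\overline H(q)=0$. Then $(H,V)$ is regularly homogenizable at every $p$ in the closed line segment between $0$ and $q$, and $\overline H(p)=0$ for every such $p$. -/

import Mathlib

open Set Filter Topology MeasureTheory
open scoped ContDiff

/-- The space `BUC(ℝ)` of real-valued bounded uniformly continuous functions on `ℝ`. -/
structure BUC where
  toFun : ℝ → ℝ
  uniformContinuous : UniformContinuous toFun
  bounded : ∃ C : ℝ, ∀ x, |toFun x| ≤ C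

namespace BUC

instance : CoeFun BUC (fun _ => ℝ → ℝ) := ⟨BUC.toFun⟩

/-- The `σ`-algebra generated by the pointwise evaluations `V ↦ V x`. -/
instance : MeasurableSpace BUC :=
  ⨆ x : ℝ, MeasurableSpace.comap (fun V : BUC => V x) (borel ℝ)

/-- The translation `(T_y V)(x) = V (x + y)`. -/
def translate (y : ℝ) (V : BUC) : BUC where
  toFun := fun x => V (x + y)
  uniformContinuous := V.uniformContinuous.comp (uniformContinuous_id.add uniformContinuous_const)
  bounded := by
    obtain ⟨C, hC⟩ := V.bounded
    exact ⟨C, fun x => hC (x + y)⟩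

end BUC

/-- The standing assumptions on the law `P` of the potential: normalization of the essential
supremum and infimum, stationarity, and ergodicity. -/
structure IsStationaryErgodicLaw (P : Measure BUC) : Prop where
  normalized : ∃ m : ℝ, 0 < m ∧
    (∀ᵐ V ∂P, essSup (fun x => V.toFun x) volume = 0) ∧
    (∀ᵐ V ∂P, essSup (fun x => -V.toFun x) volume = m)
  stationary : ∀ E : Set BUC, MeasurableSet E → ∀ y : ℝ, P E = P (BUC.translate y '' E)
  ergodic : ∀ E : Set BUC, MeasurableSet E →
    P (⋂ z : ℝ, BUC.translate z '' E) = 0 ∨ P (⋂ z : ℝ, BUC.translate z '' E) = 1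

/-- Viscosity subsolution on `ℝ` of `l v + H (p + v') + V = 0`. -/
def IsViscositySubsolution (H : ℝ → ℝ) (V : ℝ → ℝ) (l p : ℝ) (v : ℝ → ℝ) : Prop :=
  ∀ φ : ℝ → ℝ, ContDiff ℝ 1 φ → ∀ y : ℝ, IsLocalMax (fun x => v x - φ x) y →
    l * v y + H (p + deriv φ y) + V y ≤ 0

/-- Viscosity supersolution on `ℝ` of `l v + H (p + v') + V = 0`. -/
def IsViscositySupersolution (H : ℝ → ℝ) (V : ℝ → ℝ) (l p : ℝ) (v : ℝ → ℝ) : Prop :=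
  ∀ φ : ℝ → ℝ, ContDiff ℝ 1 φ → ∀ y : ℝ, IsLocalMin (fun x => v x - φ x) y →
    0 ≤ l * v y + H (p + deriv φ y) + V y

/-- `v` is a continuous bounded viscosity solution on `ℝ` of `l v + H (p + v') + V = 0`. -/
structure IsCellSolution (H : ℝ → ℝ) (V : ℝ → ℝ) (l p : ℝ) (v : ℝ → ℝ) : Prop where
  continuous : Continuous v
  bounded : ∃ C : ℝ, ∀ x, |v x| ≤ C
  subsolution : IsViscositySubsolution H V l p v
  supersolution : IsViscositySupersolution H V l p v

/-- The number `c` is an effective value at `p`: almost surely, the approximate cell problem has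
exactly one continuous bounded viscosity solution `v l` for each `l > 0`, and, for each `R > 0`,
almost surely `max_{|y| ≤ R / l} |l * v l y + c|` tends to `0` as `l → 0+`.
(The maximum is nonnegative, so its limsup is `0` iff it tends to `0`.) -/
def HasEffectiveValue (P : Measure BUC) (H : ℝ → ℝ) (p c : ℝ) : Prop :=
  (∀ᵐ V ∂P, ∀ l : ℝ, 0 < l → ∃! v : ℝ → ℝ, IsCellSolution H V.toFun l p v) ∧
  ∀ R : ℝ, 0 < R → ∀ᵐ V ∂P, ∀ v : ℝ → ℝ → ℝ,
    (∀ l : ℝ, 0 < l → IsCellSolution H V.toFun l p (v l)) →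
    Tendsto (fun l : ℝ => sSup ((fun y => |l * v l y + c|) '' Icc (-(R / l)) (R / l)))
      (𝓝[>] 0) (𝓝 0)

/-- `(H, V)`, with `V` distributed according to `P`, is regularly homogenizable at `p`. -/
structure IsRegularlyHomogenizableAt (P : Measure BUC) (H : ℝ → ℝ) (p : ℝ) : Prop where
  law : IsStationaryErgodicLaw P
  continuous : Continuous H
  coercive : Tendsto H (cocompact ℝ) atTop
  exists_value : ∃ c : ℝ, HasEffectiveValue P H p c

/-- The effective Hamiltonian `H̄(p)`: the effective value at `p` (it is unique, see
`effectiveHamiltonian_eq`), meaningful only where such a value exists. -/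
noncomputable def effectiveHamiltonian (P : Measure BUC) (H : ℝ → ℝ) (p : ℝ) : ℝ :=
  Classical.epsilon fun c : ℝ => HasEffectiveValue P H p c

theorem HasEffectiveValue.unique {P : Measure BUC} [IsProbabilityMeasure P] {H : ℝ → ℝ}
    {p c d : ℝ} (hc : HasEffectiveValue P H p c) (hd : HasEffectiveValue P H p d) : c = d := by
  obtain ⟨V, ⟨h1, h2⟩, h3⟩ :=
    ((hc.1.and (hc.2 1 one_pos)).and (hd.2 1 one_pos)).exists
  have hex : ∀ l : ℝ, ∃ v : ℝ → ℝ, 0 < l → IsCellSolution H V.toFun l p v := by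
    intro l
    by_cases hl : 0 < l
    · obtain ⟨v, hv, -⟩ := h1 l hl
      exact ⟨v, fun _ => hv⟩
    · exact ⟨0, fun h => absurd h hl⟩
  choose v hv using hex
  have key : ∀ e : ℝ, Tendsto (fun l : ℝ =>
      sSup ((fun y => |l * v l y + e|) '' Icc (-((1 : ℝ) / l)) (1 / l))) (𝓝[>] 0) (𝓝 0) →
      Tendsto (fun l : ℝ => l * v l 0 + e) (𝓝[>] 0) (𝓝 0) := by
    intro e he
    refine squeeze_zero_norm' ?_ he
    filter_upwards [self_mem_nhdsWithin] with l hl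
    have hl' : (0 : ℝ) < l := hl
    have hcont : Continuous fun y => |l * v l y + e| :=
      ((continuous_const.mul (hv l hl').continuous).add continuous_const).abs
    refine le_csSup (isCompact_Icc.image hcont).bddAbove ⟨0, ⟨?_, ?_⟩, rfl⟩
    · have : 0 < 1 / l := by positivity
      linarith
    · positivity
  have hsub := (key c (h2 v hv)).sub (key d (h3 v hv))
  have hconst : Tendsto (fun _ : ℝ => c - d) (𝓝[>] 0) (𝓝 0) := by
    simpa using hsub
  have := tendsto_nhds_unique hconst tendsto_const_nhds
  linarith

theorem effectiveHamiltonian_eq {P : Measure BUC} [IsProbabilityMeasure P] {H : ℝ → ℝ}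
    {p c : ℝ} (hc : HasEffectiveValue P H p c) : effectiveHamiltonian P H p = c :=
  HasEffectiveValue.unique (Classical.epsilon_spec (⟨c, hc⟩ : ∃ d, HasEffectiveValue P H p d)) hc

/-- `H : ℝ → [0, ∞)` is Lipschitz continuous and coercive, with `min H = H 0 = 0`. -/
structure IsNormalizedHamiltonian (H : ℝ → ℝ) : Prop where
  nonneg : ∀ p, 0 ≤ H p
  lipschitz : ∃ K : NNReal, LipschitzWith K H
  zero : H 0 = 0
  coercive : Tendsto H (cocompact ℝ) atTop

/-- On `[0, ∞)`, `H` is piecewise strictly monotone with finitely many wells, whose turning points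
`p 1 > p 2 > ... > p (2 * L + 1) = 0` are such that the critical values
`H (p 1), ..., H (p (2 * L))` at the nonzero turning points are distinct and positive. -/
def HasFiniteWellsRight (H : ℝ → ℝ) : Prop :=
  ∃ (L : ℕ) (p : ℕ → ℝ),
    (∀ i ∈ Icc 1 (2 * L), p (i + 1) < p i) ∧
    p (2 * L + 1) = 0 ∧
    StrictMonoOn H (Ici (p 1)) ∧
    (∀ k ∈ Icc 1 L, StrictMonoOn H (Icc (p (2 * k + 1)) (p (2 * k)))) ∧
    (∀ k ∈ Icc 1 L, StrictAntiOn H (Icc (p (2 * k)) (p (2 * k - 1)))) ∧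
    InjOn (fun i => H (p i)) (Icc 1 (2 * L)) ∧
    (∀ i ∈ Icc 1 (2 * L), 0 < H (p i))

/-- The mirror-image condition on `(-∞, 0]`, with turning points
`p 1 < p 2 < ... < p (2 * L + 1) = 0`. -/
def HasFiniteWellsLeft (H : ℝ → ℝ) : Prop :=
  ∃ (L : ℕ) (p : ℕ → ℝ),
    (∀ i ∈ Icc 1 (2 * L), p i < p (i + 1)) ∧
    p (2 * L + 1) = 0 ∧
    StrictAntiOn H (Iic (p 1)) ∧
    (∀ k ∈ Icc 1 L, StrictAntiOn H (Icc (p (2 * k)) (p (2 * k + 1)))) ∧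
    (∀ k ∈ Icc 1 L, StrictMonoOn H (Icc (p (2 * k - 1)) (p (2 * k)))) ∧
    InjOn (fun i => H (p i)) (Icc 1 (2 * L)) ∧
    (∀ i ∈ Icc 1 (2 * L), 0 < H (p i))

/-- `V` is smooth and none of its level sets has a cluster point. -/
structure IsRegularPotential (V : ℝ → ℝ) : Prop where
  smooth : ContDiff ℝ ∞ V
  no_cluster : ∀ c y : ℝ, ¬ AccPt y (𝓟 {x : ℝ | V x = c})

/-! The wells hypotheses enter only through `H > 0` off `0`. After a reflection, and uniqueness when
`p = q`, let `0 ≤ p < q`, with solutions `u` at `q` and `v` at `p`. The claim is that `l * v` is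
uniformly small on `[-R / l, R / l]`.

The upper bound is cheap: `H ≥ 0` forces `l * v ≤ -V` wherever `v` is touched from above, and such
points are dense (`IsViscositySubsolution.mul_le_of_lt`).

The lower bound is `IsCellSolution.le_mul_of_pos`. Suppose `l * v z < -κ - 2 * ε` although `V z >
-ε`. On the interval around `z` where `l * v < -κ`, `W = p x + v` solves `H (W') = -V - l v > κ`, so
`W` falls away from `z` at a definite rate on one side. If it falls to the right, so does `v`, as `p
≥ 0`: `l * v` cannot climb back to `-κ`, and over a distance of order `1 / l` it would break its a
priori bound. If it falls to the left, compare with `U = q x + u`. Since `l * u` and `V z` are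
nearly `0`, `U` is almost flat near `z`, so `W - U` drops just left of `z`. It has no interior
minimum further left, because doubling of variables would give `l u ≤ l v` there. Hence `W - U`
stays below its value at `z`, and `q > p` makes `v` fall leftwards up to an error `2 * ε / l`: the
same contradiction.

Points with `V > -ε` lie within `o(N)` of every point of `[-N, N]`: stationarity and `essSup V = 0`
make long low runs improbable, and the maximal ergodic inequality makes this uniform. A Lipschitz
bound for `v` independent of `l` carries the estimates to all points. Well-posedness at `p` comes
from Perron's method and comparison. -/

/-! ### Doubling of variables and comparison -/

/-- `w` is a viscosity subsolution of `H (w') = G` on the open interval `(a, b)`. -/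
def IsSubsolutionOn (H G w : ℝ → ℝ) (a b : ℝ) : Prop :=
  ∀ φ : ℝ → ℝ, ContDiff ℝ 1 φ → ∀ y ∈ Ioo a b, IsLocalMax (fun x => w x - φ x) y →
    H (deriv φ y) ≤ G y

/-- `w` is a viscosity supersolution of `H (w') = G` on the open interval `(a, b)`. -/
def IsSupersolutionOn (H G w : ℝ → ℝ) (a b : ℝ) : Prop :=
  ∀ φ : ℝ → ℝ, ContDiff ℝ 1 φ → ∀ y ∈ Ioo a b, IsLocalMin (fun x => w x - φ x) y →
    G y ≤ H (deriv φ y)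

/-- Doubling of variables: at an interior minimum of the difference of a supersolution and a
subsolution, the right-hand sides are ordered. -/
theorem exists_isMinOn_sub_and_le {H Gu Gw u w : ℝ → ℝ} {a b m : ℝ}
    (hGu : Continuous Gu) (hGw : Continuous Gw) (hu : Continuous u) (hw : Continuous w)
    (hsub : IsSubsolutionOn H Gu u a b) (hsuper : IsSupersolutionOn H Gw w a b)
    (hm : m ∈ Icc a b) (hma : w m - u m < w a - u a) (hmb : w m - u m < w b - u b) :
    ∃ x ∈ Ioo a b, w x - u x ≤ w m - u m ∧ Gw x ≤ Gu x := by
  have hexists : ∀ n : ℕ, ∃ z ∈ Icc a b ×ˢ Icc a b, ∀ z' ∈ Icc a b ×ˢ Icc a b,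
      w z.1 - u z.2 + n * (z.1 - z.2) ^ 2 ≤ w z'.1 - u z'.2 + n * (z'.1 - z'.2) ^ 2 := by
    intro n
    obtain ⟨z, hz, hmin⟩ := (isCompact_Icc.prod isCompact_Icc :
      IsCompact (Icc a b ×ˢ Icc a b)).exists_isMinOn ⟨(m, m), hm, hm⟩
      (f := fun z : ℝ × ℝ => w z.1 - u z.2 + n * (z.1 - z.2) ^ 2) (by fun_prop)
    exact ⟨z, hz, fun z' hz' => hmin hz'⟩
  choose z hz hmin using hexists
  obtain ⟨⟨x, y⟩, hxy, θ, hθ, hlim⟩ :=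
    (isCompact_Icc.prod isCompact_Icc : IsCompact (Icc a b ×ˢ Icc a b)).tendsto_subseq hz
  have hx : Tendsto (fun n => (z (θ n)).1) atTop (𝓝 x) :=
    (continuous_fst.tendsto _).comp hlim
  have hy : Tendsto (fun n => (z (θ n)).2) atTop (𝓝 y) :=
    (continuous_snd.tendsto _).comp hlim
  have hle : ∀ n, w (z n).1 - u (z n).2 + n * ((z n).1 - (z n).2) ^ 2 ≤ w m - u m := by
    intro n
    have := hmin n (m, m) ⟨hm, hm⟩
    simp only [sub_self] at this
    linarith
  have hnn : ∀ n : ℕ, 0 ≤ (n : ℝ) * ((z n).1 - (z n).2) ^ 2 := fun n => by positivity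
  have hwu : Tendsto (fun n => w (z (θ n)).1 - u (z (θ n)).2) atTop (𝓝 (w x - u y)) :=
    ((hw.tendsto x).comp hx).sub ((hu.tendsto y).comp hy)
  have hxy_le : w x - u y ≤ w m - u m :=
    le_of_tendsto' hwu fun n => by linarith [hle (θ n), hnn (θ n)]
  have heq : x = y := by
    have hsq : Tendsto (fun n => ((z (θ n)).1 - (z (θ n)).2) ^ 2) atTop (𝓝 ((x - y) ^ 2)) :=
      (hx.sub hy).pow 2
    have hbig : Tendsto (fun n => (w m - u m - (w (z (θ n)).1 - u (z (θ n)).2)) / (θ n : ℝ))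
        atTop (𝓝 0) :=
      (tendsto_const_nhds.sub hwu).div_atTop
        (tendsto_natCast_atTop_atTop.comp hθ.tendsto_atTop)
    have h0 : (x - y) ^ 2 ≤ 0 := by
      refine le_of_tendsto_of_tendsto hsq hbig ?_
      filter_upwards [eventually_gt_atTop 0] with n hn
      have hpos : (0 : ℝ) < θ n := by
        exact_mod_cast lt_of_lt_of_le hn (hθ.id_le n)
      rw [le_div_iff₀ hpos]
      linarith [hle (θ n)]
    have := pow_eq_zero_iff (two_ne_zero) |>.1 (le_antisymm h0 (sq_nonneg (x - y)))
    linarith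
  subst heq
  have hxI : x ∈ Ioo a b := by
    refine ⟨lt_of_le_of_ne hxy.1.1 ?_, lt_of_le_of_ne hxy.1.2 ?_⟩
    · rintro rfl; linarith
    · rintro rfl; linarith
  refine ⟨x, hxI, hxy_le, ?_⟩
  refine le_of_tendsto_of_tendsto ((hGw.tendsto x).comp hx) ((hGu.tendsto x).comp hy) ?_
  filter_upwards [hx.eventually (Ioo_mem_nhds hxI.1 hxI.2),
    hy.eventually (Ioo_mem_nhds hxI.1 hxI.2)] with n h1 h2
  have hderiv : ∀ (c s t : ℝ), deriv (fun x : ℝ => c * (x - s) ^ 2) t = c * (2 * (t - s)) := by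
    intro c s t
    simp
  -- Freezing one variable at the minimum gives test parabolas for `w` and `u` with the same slope,
  -- so the two `H` terms coincide.
  have hw' := hsuper (fun x => (-(θ n : ℝ)) * (x - (z (θ n)).2) ^ 2) (by fun_prop) _ h1 (by
    filter_upwards [Ioo_mem_nhds h1.1 h1.2] with t ht
    have := hmin (θ n) (t, (z (θ n)).2) ⟨Ioo_subset_Icc_self ht, (hz _).2⟩
    dsimp only at this ⊢
    linarith)
  have hu' := hsub (fun x => (θ n : ℝ) * (x - (z (θ n)).1) ^ 2) (by fun_prop) _ h2 (by
    filter_upwards [Ioo_mem_nhds h2.1 h2.2] with t ht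
    have := hmin (θ n) ((z (θ n)).1, t) ⟨(hz _).1, Ioo_subset_Icc_self ht⟩
    dsimp only at this ⊢
    nlinarith)
  rw [hderiv] at hw' hu'
  have hs : -(θ n : ℝ) * (2 * ((z (θ n)).1 - (z (θ n)).2)) =
      (θ n : ℝ) * (2 * ((z (θ n)).2 - (z (θ n)).1)) := by ring
  rw [hs] at hw'
  exact hw'.trans hu'

theorem IsViscositySubsolution.isSubsolutionOn {H V v : ℝ → ℝ} {l p : ℝ}
    (h : IsViscositySubsolution H V l p v) (a b : ℝ) :
    IsSubsolutionOn (fun s => H (p + s)) (fun x => -V x - l * v x) v a b := by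
  intro φ hφ y _ hy
  have := h φ hφ y hy
  dsimp only
  linarith

/-- Comparison principle on the line for bounded continuous sub- and supersolutions. -/
theorem IsViscositySubsolution.le {H V u v : ℝ → ℝ} {l p : ℝ} {K : NNReal}
    (hH : LipschitzWith K H) (hV : Continuous V) (hl : 0 < l)
    (hu : Continuous u) (hub : ∃ C, ∀ x, |u x| ≤ C)
    (hv : Continuous v) (hvb : ∃ C, ∀ x, |v x| ≤ C)
    (hsub : IsViscositySubsolution H V l p u) (hsuper : IsViscositySupersolution H V l p v)
    (x : ℝ) : u x ≤ v x := by
  by_contra! hlt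
  obtain ⟨C, hC⟩ := hub
  obtain ⟨C', hC'⟩ := hvb
  set s : ℝ → ℝ := fun t => √(1 + t ^ 2) with hs
  have hs1 : ∀ t, 1 ≤ s t := fun t => by
    rw [hs]; exact Real.one_le_sqrt.2 (by nlinarith [sq_nonneg t])
  have hsabs : ∀ t, |t| ≤ s t := fun t => by
    rw [hs]; exact Real.abs_le_sqrt (by linarith)
  have hscont : ContDiff ℝ 1 s :=
    ContDiff.sqrt (by fun_prop) (fun t => by positivity)
  have hsderiv : ∀ t, |deriv s t| ≤ 1 := by
    intro t
    have h1 : HasDerivAt (fun t : ℝ => 1 + t ^ 2) (2 * t) t := by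
      simpa using ((hasDerivAt_id t).pow 2).const_add 1
    have h2 := h1.sqrt (by positivity)
    rw [hs, h2.deriv, abs_div, abs_of_pos (by positivity : 0 < 2 * √(1 + t ^ 2)),
      div_le_one (by positivity), abs_mul, abs_two]
    have := hsabs t
    rw [hs] at this
    linarith
  set d := u x - v x with hd
  have hdpos : 0 < d := by linarith
  have hK : 0 ≤ (K : ℝ) := K.2
  -- The penalty costs `K * σ` through the Lipschitz bound on `H` and `l * σ * s x` at `x`; this `σ`
  -- makes the total `l * d / 2`.
  set σ := l * d / (2 * (K + l * s x)) with hσ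
  have hden : 0 < K + l * s x := by have := hs1 x; positivity
  have hσpos : 0 < σ := by positivity
  have hσeq : σ * (K + l * s x) = l * d / 2 := by rw [hσ]; field_simp
  set w : ℝ → ℝ := fun t => v t + σ * s t with hw
  set B := |x| + (C + C' + σ * s x) / σ + 1 with hB
  have hCC : |u x| + |v x| ≤ C + C' := add_le_add (hC x) (hC' x)
  have hCCnn : 0 ≤ C + C' := le_trans (by positivity) hCC
  have hxB : |x| ≤ B := by
    have : 0 ≤ (C + C' + σ * s x) / σ := by have := hs1 x; positivity
    linarith
  have hBσ : C + C' + σ * s x < σ * B := by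
    have h1 : σ * ((C + C' + σ * s x) / σ) = C + C' + σ * s x := by field_simp
    have h2 : 0 ≤ σ * |x| := by positivity
    rw [hB]; nlinarith
  have hend : ∀ t, |t| = B → w x - u x < w t - u t := by
    intro t ht
    have h1 := hsabs t
    rw [ht] at h1
    have h2 : σ * B ≤ σ * s t := by gcongr
    have h3 := abs_le.1 (hC t)
    have h4 := abs_le.1 (hC' t)
    simp only [hw]
    linarith
  have hB0 : 0 ≤ B := (abs_nonneg x).trans hxB
  have hwsuper : IsSupersolutionOn (fun s => H (p + s))
      (fun t => -V t - l * v t - K * σ) w (-B) B := by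
    intro φ hφ y _ hy
    have h1 := hsuper (fun t => φ t - σ * s t) (hφ.sub (contDiff_const.mul hscont)) y (by
      refine hy.congr (Eventually.of_forall fun t => ?_)
      simp only [hw]; ring)
    have h2 : deriv (fun t => φ t - σ * s t) y = deriv φ y - σ * deriv s y := by
      rw [deriv_fun_sub (hφ.differentiable (by simp) y)
        ((hscont.differentiable (by simp) y).const_mul σ), deriv_const_mul_field]
    rw [h2] at h1
    have h3 := hH.dist_le_mul (p + (deriv φ y - σ * deriv s y)) (p + deriv φ y)
    rw [Real.dist_eq, Real.dist_eq] at h3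
    have h4 : |p + (deriv φ y - σ * deriv s y) - (p + deriv φ y)| ≤ σ := by
      rw [show p + (deriv φ y - σ * deriv s y) - (p + deriv φ y) = -(σ * deriv s y) by ring,
        abs_neg, abs_mul, abs_of_pos hσpos]
      have := hsderiv y
      nlinarith
    have h5 := (abs_le.1 h3).2
    have h6 := mul_le_mul_of_nonneg_left h4 hK
    dsimp only
    linarith
  obtain ⟨t, -, ht1, ht2⟩ := exists_isMinOn_sub_and_le (by fun_prop) (by fun_prop) hu
    (hv.add (continuous_const.mul hscont.continuous)) (hsub.isSubsolutionOn (-B) B) hwsuper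
    (abs_le.1 hxB) (hend _ (by rw [abs_neg, abs_of_nonneg hB0])) (hend _ (abs_of_nonneg hB0))
  have ht1' : v t + σ * s t - u t ≤ v x + σ * s x - u x := ht1
  have h1 : d - σ * s x ≤ u t - v t := by
    have : 0 ≤ σ * s t := by have := hs1 t; positivity
    linarith
  have h2 : l * (d - σ * s x) ≤ l * (u t - v t) := by gcongr
  nlinarith

/-! ### Lipschitz bounds and existence by Perron's method -/

/-- A bounded continuous function touched from above only by lines of slope less than `Λ` is
`Λ`-Lipschitz. -/
theorem abs_sub_le_of_forall_isLocalMax {u : ℝ → ℝ} {Λ : ℝ} (hu : Continuous u)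
    (hub : ∃ C, ∀ x, |u x| ≤ C) (hΛ : 0 < Λ)
    (h : ∀ a y : ℝ, IsLocalMax (fun x => u x - a * x) y → |a| < Λ) (x y : ℝ) :
    |u x - u y| ≤ Λ * |x - y| := by
  obtain ⟨C, hC⟩ := hub
  have key : ∀ x y, u x - u y ≤ Λ * |x - y| := by
    intro x y
    by_contra! hlt
    -- At distance `B` the cone `Λ * |t - y|` exceeds the oscillation `2 * C`, so the maximum is
    -- interior. It is not the vertex either, so a line of slope `±Λ` touches `u`.
    set B := |x - y| + 2 * C / Λ + 1 with hB
    have hC0 : 0 ≤ C := (abs_nonneg _).trans (hC x)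
    have hB0 : 0 < B := by positivity
    have hBΛ : 2 * C < Λ * B := by
      have h1 : Λ * (2 * C / Λ) = 2 * C := by field_simp
      have h2 : 0 ≤ Λ * |x - y| := by positivity
      rw [hB]; nlinarith
    obtain ⟨t, ht, hmax⟩ := (isCompact_Icc (a := y - B) (b := y + B)).exists_isMaxOn
      ⟨y, by constructor <;> linarith⟩ (f := fun t => u t - Λ * |t - y|) (by fun_prop)
    have hxmem : x ∈ Icc (y - B) (y + B) := by
      have h0 : 0 ≤ 2 * C / Λ := by positivity
      have h1 := abs_le.1 (show |x - y| ≤ B by linarith)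
      constructor <;> linarith
    have hx := hmax hxmem
    dsimp only at hx
    have hval : u y < u t - Λ * |t - y| := by simp only [mem_ofPred_eq] at hx; linarith
    have hint : ∀ s, |s - y| = B → t ≠ s := by
      rintro s hs rfl
      rw [hs] at hval
      linarith [(abs_le.1 (hC t)).2, (abs_le.1 (hC y)).1]
    have htI : t ∈ Ioo (y - B) (y + B) := by
      refine ⟨lt_of_le_of_ne ht.1 (hint _ ?_).symm, lt_of_le_of_ne ht.2 (hint _ ?_)⟩
      · rw [show y - B - y = -B by ring, abs_neg, abs_of_pos hB0]
      · rw [show y + B - y = B by ring, abs_of_pos hB0]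
    have hne : t ≠ y := by
      rintro rfl; simp at hval
    rcases lt_or_gt_of_ne hne with hlt' | hgt
    · have := h (-Λ) t (by
        filter_upwards [Ioo_mem_nhds htI.1 hlt'] with s hs
        have := hmax ⟨hs.1.le, by linarith [hs.2]⟩
        simp only [mem_ofPred_eq] at this
        rw [abs_of_neg (by linarith [hs.2]), abs_of_neg (by linarith)] at this
        linarith)
      rw [abs_neg, abs_of_pos hΛ] at this
      exact lt_irrefl _ this
    · have := h Λ t (by
        filter_upwards [Ioo_mem_nhds hgt htI.2] with s hs
        have := hmax ⟨by linarith [hs.1], hs.2.le⟩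
        simp only [mem_ofPred_eq] at this
        rw [abs_of_pos (by linarith [hs.1]), abs_of_pos (by linarith)] at this
        linarith)
      rw [abs_of_pos hΛ] at this
      exact lt_irrefl _ this
  refine abs_le.2 ⟨?_, key x y⟩
  have := key y x
  rw [abs_sub_comm] at this
  linarith

theorem exists_forall_le_imp_abs_lt {H : ℝ → ℝ} (hH : Tendsto H (cocompact ℝ) atTop) (p C : ℝ) :
    ∃ Λ : ℝ, 0 < Λ ∧ ∀ a, H (p + a) ≤ C → |a| < Λ := by
  obtain ⟨t, ht, hsub⟩ := mem_cocompact.1 (hH.eventually_gt_atTop C)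
  obtain ⟨r, hr⟩ := ht.isBounded.subset_closedBall 0
  refine ⟨|r| + |p| + 1, by positivity, fun a ha => ?_⟩
  have hmem : p + a ∈ t := by
    by_contra hn
    exact absurd (hsub hn) (not_lt.2 ha)
  have h1 := hr hmem
  rw [mem_closedBall_zero_iff, Real.norm_eq_abs] at h1
  have h2 : |a| ≤ |p + a| + |p| := by
    simpa using abs_sub (p + a) p
  linarith [le_abs_self r]

/-- A subsolution bounded below by `-C / l` is touched from above only by lines of bounded
slope. -/
theorem IsViscositySubsolution.abs_slope_lt {H V w : ℝ → ℝ} {l p C Λ : ℝ}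
    (hw : IsViscositySubsolution H V l p w) (hV : ∀ x, -C ≤ V x) (hwC : ∀ x, -C ≤ l * w x)
    (hΛ : ∀ a, H (p + a) ≤ 2 * C → |a| < Λ) (a y : ℝ)
    (h : IsLocalMax (fun x => w x - a * x) y) : |a| < Λ := by
  have := hw (fun x => a * x) (by fun_prop) y h
  rw [show deriv (fun x : ℝ => a * x) y = a by simp] at this
  exact hΛ a (by linarith [hV y, hwC y])

/-- The continuous subsolutions with values in `[-C / l, C / l]`. -/
def boundedSubsolutions (H V : ℝ → ℝ) (l p C : ℝ) : Set (ℝ → ℝ) :=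
  {w | Continuous w ∧ (∀ x, |w x| ≤ C / l) ∧ IsViscositySubsolution H V l p w}

/-- Perron's candidate: the supremum of the bounded subsolutions. -/
noncomputable def perron (H V : ℝ → ℝ) (l p C : ℝ) (x : ℝ) : ℝ :=
  ⨆ w : boundedSubsolutions H V l p C, w.1 x

/-- A differentiable function lying above a cone of half-width `τ` has derivative within `τ` of
the axis of the cone. -/
theorem abs_sub_le_of_hasDerivAt_of_eventually_le {f : ℝ → ℝ} {a b x τ : ℝ}
    (hf : HasDerivAt f b x)
    (h : ∀ᶠ t in 𝓝 x, a * (t - x) - τ * |t - x| ≤ f t - f x) : |b - a| ≤ τ := by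
  have hslope := hasDerivAt_iff_tendsto_slope.1 hf
  refine abs_le.2 ⟨?_, ?_⟩
  · have h1 : Tendsto (slope f x) (𝓝[>] x) (𝓝 b) :=
      hslope.mono_left (nhdsWithin_mono x fun t ht => ne_of_gt ht)
    have := ge_of_tendsto h1 (b := a - τ) (by
      filter_upwards [nhdsWithin_le_nhds h, self_mem_nhdsWithin] with t ht hxt
      have hpos : 0 < t - x := sub_pos.2 hxt
      rw [abs_of_pos hpos] at ht
      rw [slope_def_field, le_div_iff₀ hpos]
      linarith)
    linarith
  · have h1 : Tendsto (slope f x) (𝓝[<] x) (𝓝 b) :=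
      hslope.mono_left (nhdsWithin_mono x fun t ht => ne_of_lt ht)
    have := le_of_tendsto h1 (b := a + τ) (by
      filter_upwards [nhdsWithin_le_nhds h, self_mem_nhdsWithin] with t ht hxt
      have hneg : t - x < 0 := sub_neg.2 hxt
      rw [abs_of_neg hneg] at ht
      rw [slope_def_field, div_le_iff_of_neg hneg]
      linarith)
    linarith

section Perron

variable {H V : ℝ → ℝ} {l p C Λ : ℝ}

theorem const_mem_boundedSubsolutions (hl : 0 < l) (hC : ∀ x, |V x| + H p ≤ C) (hC0 : 0 ≤ C) :
    (fun _ => -(C / l)) ∈ boundedSubsolutions H V l p C := by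
  refine ⟨continuous_const, fun x => ?_, ?_⟩
  · rw [abs_neg, abs_of_nonneg (by positivity)]
  · intro φ hφ y hy
    have h1 : deriv φ y = 0 := by
      have := hy.deriv_eq_zero
      rw [deriv_const_sub] at this
      linarith
    have h2 : l * -(C / l) = -C := by field_simp
    rw [h1, h2, add_zero]
    linarith [hC y, le_abs_self (V y)]

theorem bddAbove_range_boundedSubsolutions (x : ℝ) :
    BddAbove (range fun w : boundedSubsolutions H V l p C => w.1 x) :=
  ⟨C / l, by rintro _ ⟨w, rfl⟩; exact (abs_le.1 (w.2.2.1 x)).2⟩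

theorem le_perron {w : ℝ → ℝ} (hw : w ∈ boundedSubsolutions H V l p C) (x : ℝ) :
    w x ≤ perron H V l p C x :=
  le_ciSup (f := fun w : boundedSubsolutions H V l p C => w.1 x)
    (bddAbove_range_boundedSubsolutions x) ⟨w, hw⟩

/-- One constant serves the whole family, which is what makes its supremum continuous. -/
theorem lipschitz_of_mem_boundedSubsolutions {w : ℝ → ℝ} (hl : 0 < l)
    (hC : ∀ x, |V x| ≤ C) (hΛ0 : 0 < Λ)
    (hΛ : ∀ a, H (p + a) ≤ 2 * C → |a| < Λ) (hw : w ∈ boundedSubsolutions H V l p C) (x y : ℝ) :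
    |w x - w y| ≤ Λ * |x - y| := by
  refine abs_sub_le_of_forall_isLocalMax hw.1 ⟨_, hw.2.1⟩ hΛ0
    (hw.2.2.abs_slope_lt (fun x => (abs_le.1 (hC x)).1) (fun x => ?_) hΛ) x y
  have h1 := (abs_le.1 (hw.2.1 x)).1
  have h2 : l * -(C / l) = -C := by field_simp
  rw [← h2]
  gcongr

variable (hl : 0 < l) (hC : ∀ x, |V x| + H p ≤ C) (hHp : 0 ≤ H p) (hΛ0 : 0 < Λ)
  (hΛ : ∀ a, H (p + a) ≤ 2 * C → |a| < Λ)

include hl hC hHp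

theorem nonempty_boundedSubsolutions : Nonempty (boundedSubsolutions H V l p C) :=
  ⟨⟨_, const_mem_boundedSubsolutions hl hC
    (le_trans (by have := abs_nonneg (V 0); linarith) (hC 0))⟩⟩

theorem abs_perron_le (x : ℝ) : |perron H V l p C x| ≤ C / l := by
  have hC0 : 0 ≤ C := le_trans (by have := abs_nonneg (V 0); linarith) (hC 0)
  have := nonempty_boundedSubsolutions hl hC hHp
  exact abs_le.2 ⟨le_perron (const_mem_boundedSubsolutions hl hC hC0) x,
    ciSup_le fun w => (abs_le.1 (w.2.2.1 x)).2⟩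

include hΛ0 hΛ

theorem abs_perron_sub_le (x y : ℝ) :
    |perron H V l p C x - perron H V l p C y| ≤ Λ * |x - y| := by
  have := nonempty_boundedSubsolutions hl hC hHp
  have key : ∀ x y, perron H V l p C x ≤ perron H V l p C y + Λ * |x - y| := by
    intro x y
    refine ciSup_le fun w => ?_
    have h1 := (abs_le.1 (lipschitz_of_mem_boundedSubsolutions hl
      (fun x => by linarith [hC x]) hΛ0 hΛ w.2 x y)).2
    linarith [le_perron w.2 y]
  refine abs_le.2 ⟨?_, by linarith [key x y]⟩
  have := key y x
  rw [abs_sub_comm] at this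
  linarith

theorem continuous_perron : Continuous (perron H V l p C) := by
  refine LipschitzWith.continuous (K := ⟨Λ, hΛ0.le⟩) (LipschitzWith.of_dist_le_mul fun x y => ?_)
  exact abs_perron_sub_le hl hC hHp hΛ0 hΛ x y

theorem isViscositySubsolution_perron (hH : Continuous H) (hV : Continuous V) :
    IsViscositySubsolution H V l p (perron H V l p C) := by
  intro φ hφ y hy
  by_contra! hpos
  have := nonempty_boundedSubsolutions hl hC hHp
  set v := perron H V l p C with hv
  have hφ' : Continuous (deriv φ) := hφ.continuous_deriv le_rfl
  have hF : Continuous fun z : ℝ × ℝ × ℝ => l * z.2.1 + H (p + (deriv φ z.1 + z.2.2)) + V z.1 := by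
    fun_prop
  have hev : ∀ᶠ z : ℝ × ℝ × ℝ in 𝓝 (y, v y, 0),
      0 < l * z.2.1 + H (p + (deriv φ z.1 + z.2.2)) + V z.1 :=
    (hF.tendsto (y, v y, 0)).eventually_const_lt (by simpa using hpos)
  obtain ⟨ρ, hρ, hball⟩ := Metric.eventually_nhds_iff.1 hev
  obtain ⟨r₁, hr₁, hloc⟩ := Metric.eventually_nhds_iff.1 hy
  set r := min (r₁ / 2) (ρ / (2 * (Λ + 2))) with hr
  have hrpos : 0 < r := by positivity
  have hrr : r < r₁ := (min_le_left _ _).trans_lt (by linarith)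
  have hrρ : r * (Λ + 2) < ρ := by
    calc r * (Λ + 2) ≤ ρ / (2 * (Λ + 2)) * (Λ + 2) := by gcongr; exact min_le_right _ _
      _ = ρ / 2 := by field_simp
      _ < ρ := by linarith
  -- `η ≤ r ^ 2` lets the added quadratic keep the maximum interior; `η ≤ r` keeps `w t` close to `v
  -- y`.
  set η := min (r ^ 2) r with hη
  have hηpos : 0 < η := by positivity
  obtain ⟨⟨w, hw⟩, hwy⟩ := exists_lt_of_lt_ciSup
    (show v y - η < ⨆ w : boundedSubsolutions H V l p C, w.1 y by
      change v y - η < v y; linarith)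
  dsimp only at hwy
  obtain ⟨t, ht, hmax⟩ := (isCompact_Icc (a := y - r) (b := y + r)).exists_isMaxOn
    ⟨y, by constructor <;> linarith⟩ (f := fun t => w t - φ t - (t - y) ^ 2)
    (by have := hw.1; have := hφ.continuous; fun_prop)
  have hval : w y - φ y ≤ w t - φ t - (t - y) ^ 2 := by
    have := hmax (show y ∈ Icc (y - r) (y + r) by constructor <;> linarith)
    simpa using this
  have hend : ∀ s, |s - y| = r → t ≠ s := by
    rintro s hs rfl
    have h1 := hloc (show dist t y < r₁ by rw [Real.dist_eq, hs]; exact hrr)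
    have h2 := le_perron hw t
    rw [← sq_abs (t - y), hs] at hval
    have h3 : η ≤ r ^ 2 := min_le_left _ _
    dsimp only at h1
    linarith
  have htI : t ∈ Ioo (y - r) (y + r) := by
    refine ⟨lt_of_le_of_ne ht.1 (hend _ ?_).symm, lt_of_le_of_ne ht.2 (hend _ ?_)⟩
    · rw [show y - r - y = -r by ring, abs_neg, abs_of_pos hrpos]
    · rw [show y + r - y = r by ring, abs_of_pos hrpos]
  have hty : |t - y| < r := abs_lt.2 ⟨by linarith [htI.1], by linarith [htI.2]⟩
  have htest := hw.2.2 (fun x => φ x + (x - y) ^ 2) (by fun_prop) t (by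
    filter_upwards [Ioo_mem_nhds htI.1 htI.2] with s hs
    have := hmax (Ioo_subset_Icc_self hs)
    simp only [mem_ofPred_eq] at this
    linarith)
  have hd : deriv (fun x => φ x + (x - y) ^ 2) t = deriv φ t + 2 * (t - y) := by
    have h1 := (((hasDerivAt_id t).sub_const y).pow 2)
    have h2 : HasDerivAt (fun x => φ x + (x - y) ^ 2) (deriv φ t + 2 * (t - y)) t := by
      simpa using (hφ.differentiable (by simp) t).hasDerivAt.fun_add h1
    exact h2.deriv
  rw [hd] at htest
  have hwv : |w t - v y| < r * (Λ + 2) := by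
    have h1 := abs_le.1 (lipschitz_of_mem_boundedSubsolutions hl
      (fun x => by linarith [hC x]) hΛ0 hΛ hw t y)
    have h2 := le_perron hw y
    have h3 : Λ * |t - y| ≤ Λ * r := by gcongr
    have h4 : η ≤ r := min_le_right _ _
    rw [abs_lt]
    constructor <;> nlinarith
  have := @hball (t, w t, 2 * (t - y)) (by
    rw [Prod.dist_eq, Prod.dist_eq, max_lt_iff, max_lt_iff, Real.dist_eq, Real.dist_eq,
      Real.dist_eq]
    refine ⟨by nlinarith, by linarith, ?_⟩
    rw [sub_zero, abs_mul, abs_two]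
    nlinarith)
  dsimp only at this
  linarith

/-- Where the supersolution test fails, the candidate can be raised by a small tent and remain a
bounded subsolution, contradicting maximality. -/
theorem isViscositySupersolution_perron (hH : Continuous H) (hV : Continuous V) :
    IsViscositySupersolution H V l p (perron H V l p C) := by
  intro φ hφ y hy
  by_contra! hneg
  set v := perron H V l p C with hv
  have hC0 : 0 ≤ C := le_trans (by have := abs_nonneg (V 0); linarith) (hC 0)
  have hvC := abs_perron_le (V := V) hl hC hHp
  have hvcont : Continuous v := continuous_perron hl hC hHp hΛ0 hΛ
  set a := deriv φ y with ha
  have hφd : HasDerivAt φ a y := (hφ.differentiable (by simp) y).hasDerivAt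
  -- There must be room below the ceiling: if `v y = C / l`, then `φ` has a local minimum at `y` and
  -- the failed test would read `C + H p + V y < 0`.
  have hlt : v y < C / l := by
    refine lt_of_le_of_ne (abs_le.1 (hvC y)).2 fun heq => ?_
    have h0 : a = 0 := by
      have hmin : IsLocalMax φ y := by
        filter_upwards [hy] with t ht
        have := (abs_le.1 (hvC t)).2
        linarith
      exact hmin.deriv_eq_zero
    rw [h0, add_zero, heq, show l * (C / l) = C by field_simp] at hneg
    linarith [hC y, neg_abs_le (V y)]
  have hF : Continuous fun z : ℝ × ℝ × ℝ => l * z.2.1 + H (p + z.2.2) + V z.1 := by fun_prop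
  have hev : ∀ᶠ z : ℝ × ℝ × ℝ in 𝓝 (y, v y, a),
      l * z.2.1 + H (p + z.2.2) + V z.1 < 0 :=
    (hF.tendsto (y, v y, a)).eventually_lt_const (by simpa using hneg)
  obtain ⟨ρ, hρ, hball⟩ := Metric.eventually_nhds_iff.1 hev
  set τ := ρ / 2 with hτ
  have hτpos : 0 < τ := by positivity
  have hlow : ∀ᶠ x in 𝓝 y, v y + a * (x - y) - τ / 2 * |x - y| ≤ v x := by
    filter_upwards [hy, hφd.isLittleO.bound (show 0 < τ / 2 by positivity)] with x h1 h2
    rw [Real.norm_eq_abs, Real.norm_eq_abs, smul_eq_mul] at h2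
    have := (abs_le.1 h2).1
    linarith
  obtain ⟨r₁, hr₁, hloc⟩ := Metric.eventually_nhds_iff.1 hlow
  have hμpos : 0 < C / l - v y := by linarith
  set μ := min ρ (C / l - v y) with hμ
  have hμ0 : 0 < μ := by positivity
  have hμρ : μ ≤ ρ := min_le_left _ _
  have hμv : μ ≤ C / l - v y := min_le_right _ _
  set r := min (r₁ / 3) (μ / (2 * (|a| + τ + 1))) with hr
  have hrpos : 0 < r := by positivity
  have hrr : 2 * r < r₁ := by
    have : r ≤ r₁ / 3 := min_le_left _ _
    linarith
  have hrμ : r * (|a| + τ + 1) ≤ μ / 2 := by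
    calc r * (|a| + τ + 1) ≤ μ / (2 * (|a| + τ + 1)) * (|a| + τ + 1) := by
          gcongr; exact min_le_right _ _
      _ = μ / 2 := by field_simp
  obtain ⟨δ, hδ0, hδ⟩ := exists_between (show 0 < min (τ / 2 * r) (μ / 2) by positivity)
  have hδ1 : δ < τ / 2 * r := hδ.trans_le (min_le_left _ _)
  have hδ2 : δ < μ / 2 := hδ.trans_le (min_le_right _ _)
  have haΛ : 0 ≤ |a| := abs_nonneg a
  -- The tent has slopes `a ± τ`, hence only subsolution slopes near `y`. Beyond radius `r`, the gap
  -- between `τ` and `τ / 2` puts it under `v` up to `2 * r`, and the steep term beats the Lipschitz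
  -- bound of `v` from there on.
  set ψ : ℝ → ℝ := fun x =>
    v y + a * (x - y) - τ * |x - y| - 2 * (|a| + Λ) * max (|x - y| - r) 0 + δ with hψ
  have hψcont : Continuous ψ := by fun_prop
  have hnear : ∀ x, v x < ψ x → |x - y| < r := by
    intro x hx
    by_contra! hge
    simp only [hψ, max_eq_left (sub_nonneg.2 hge)] at hx
    rcases lt_or_ge (|x - y|) (2 * r) with h2 | h2
    · have h3 := hloc (show dist x y < r₁ by rw [Real.dist_eq]; linarith)
      have h4 : 0 ≤ 2 * (|a| + Λ) * (|x - y| - r) := by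
        have := sub_nonneg.2 hge
        positivity
      nlinarith
    · have h3 := (abs_le.1 (abs_perron_sub_le (V := V) hl hC hHp hΛ0 hΛ x y)).1
      have h4 : 2 * (|a| + Λ) * (|x - y| / 2) ≤ 2 * (|a| + Λ) * (|x - y| - r) := by
        gcongr; linarith
      have h5 : a * (x - y) ≤ |a| * |x - y| := by rw [← abs_mul]; exact le_abs_self _
      nlinarith
  have hψnear : ∀ x, |x - y| < r → ψ x = v y + a * (x - y) - τ * |x - y| + δ := by
    intro x hx
    simp only [hψ, max_eq_right (sub_nonpos.2 hx.le)]
    ring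
  have hψv : ∀ x, |x - y| < r → |ψ x - v y| < μ := by
    intro x hx
    rw [hψnear x hx]
    have h1 : |a * (x - y)| ≤ |a| * r := by rw [abs_mul]; gcongr
    have h2 := abs_le.1 h1
    have h3 : τ * |x - y| ≤ τ * r := by gcongr
    have h4 : 0 ≤ τ * |x - y| := by positivity
    rw [abs_lt]
    constructor <;> nlinarith
  set w : ℝ → ℝ := fun x => max (v x) (ψ x) with hw
  have hwmem : w ∈ boundedSubsolutions H V l p C := by
    refine ⟨hvcont.max hψcont, fun x => ?_, ?_⟩
    · refine abs_le.2 ⟨(abs_le.1 (hvC x)).1.trans (le_max_left _ _),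
        max_le (abs_le.1 (hvC x)).2 ?_⟩
      rcases le_or_gt (ψ x) (v x) with h | h
      · exact h.trans (abs_le.1 (hvC x)).2
      · have := (abs_lt.1 (hψv x (hnear x h))).2
        linarith
    · intro χ hχ x hx
      rcases le_or_gt (ψ x) (v x) with h | h
      · have hwx : w x = v x := max_eq_left h
        rw [hwx]
        refine isViscositySubsolution_perron hl hC hHp hΛ0 hΛ hH hV χ hχ x ?_
        filter_upwards [hx] with t ht
        rw [hwx] at ht
        have : v t ≤ w t := le_max_left _ _
        linarith
      · have hwx : w x = ψ x := max_eq_right h.le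
        have hxr := hnear x h
        set b := deriv χ x with hb
        have hslope : |b - a| ≤ τ := by
          refine abs_sub_le_of_hasDerivAt_of_eventually_le
            (hχ.differentiable (by simp) x).hasDerivAt ?_
          have hopen : ∀ᶠ t in 𝓝 x, |t - y| < r :=
            (show Continuous fun t : ℝ => |t - y| by fun_prop).tendsto x |>.eventually_lt_const hxr
          filter_upwards [hx, hopen] with t ht htr
          rw [hwx, hψnear x hxr] at ht
          have h1 : ψ t ≤ w t := le_max_right _ _
          rw [hψnear t htr] at h1
          have h2 : |t - y| ≤ |x - y| + |t - x| := by
            have := abs_add_le (x - y) (t - x)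
            rwa [show x - y + (t - x) = t - y by ring] at this
          have h3 : τ * |t - y| ≤ τ * (|x - y| + |t - x|) := by gcongr
          linarith
        have := @hball (x, w x, b) (by
          rw [Prod.dist_eq, Prod.dist_eq, max_lt_iff, max_lt_iff, Real.dist_eq, Real.dist_eq,
            Real.dist_eq]
          refine ⟨?_, ?_, by linarith⟩
          · dsimp only
            nlinarith
          · rw [hwx]
            exact (hψv x hxr).trans_le hμρ)
        exact this.le
  have h1 := le_perron hwmem y
  have h2 : ψ y ≤ w y := le_max_right _ _
  have h3 : ψ y = v y + δ := by rw [hψnear y (by simpa using hrpos)]; simp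
  linarith

end Perron

/-- Existence of a bounded continuous viscosity solution of the approximate cell problem. -/
theorem exists_isCellSolution {H V : ℝ → ℝ} {l : ℝ} (p : ℝ) (hH : Continuous H)
    (hHnn : ∀ s, 0 ≤ H s) (hcoer : Tendsto H (cocompact ℝ) atTop) (hV : Continuous V)
    (hVb : ∃ C, ∀ x, |V x| ≤ C) (hl : 0 < l) : ∃ v, IsCellSolution H V l p v := by
  obtain ⟨C, hC⟩ := hVb
  have hC' : ∀ x, |V x| + H p ≤ C + H p := fun x => by linarith [hC x]
  obtain ⟨Λ, hΛ0, hΛ⟩ := exists_forall_le_imp_abs_lt hcoer p (2 * (C + H p))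
  exact ⟨perron H V l p (C + H p), continuous_perron hl hC' (hHnn p) hΛ0 hΛ,
    ⟨_, abs_perron_le hl hC' (hHnn p)⟩,
    isViscositySubsolution_perron hl hC' (hHnn p) hΛ0 hΛ hH hV,
    isViscositySupersolution_perron hl hC' (hHnn p) hΛ0 hΛ hH hV⟩

/-! ### Uniqueness and a priori bounds -/

namespace IsCellSolution

variable {H V v : ℝ → ℝ} {l p : ℝ} {K : NNReal}

theorem unique {w : ℝ → ℝ} (hH : LipschitzWith K H) (hV : Continuous V) (hl : 0 < l)
    (hv : IsCellSolution H V l p v) (hw : IsCellSolution H V l p w) : v = w :=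
  funext fun x => le_antisymm
    (IsViscositySubsolution.le hH hV hl hv.continuous hv.bounded hw.continuous hw.bounded
      hv.subsolution hw.supersolution x)
    (IsViscositySubsolution.le hH hV hl hw.continuous hw.bounded hv.continuous hv.bounded
      hw.subsolution hv.supersolution x)

theorem abs_mul_le {C : ℝ} (hH : LipschitzWith K H) (hHnn : 0 ≤ H p) (hV : Continuous V)
    (hl : 0 < l) (hC : ∀ x, |V x| + H p ≤ C) (hv : IsCellSolution H V l p v) (x : ℝ) :
    |l * v x| ≤ C := by
  have hlc : ∀ c : ℝ, l * (c / l) = c := fun c => by field_simp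
  have hlow := IsViscositySubsolution.le (u := fun _ => -C / l) hH hV hl continuous_const
    ⟨_, fun _ => le_rfl⟩ hv.continuous hv.bounded (fun φ _ y hy => by
      have h1 : deriv φ y = 0 := by
        have := hy.deriv_eq_zero
        rw [deriv_const_sub] at this
        linarith
      rw [hlc, h1, add_zero]
      linarith [hC y, le_abs_self (V y)]) hv.supersolution x
  have hup := IsViscositySubsolution.le (v := fun _ => C / l) hH hV hl hv.continuous hv.bounded
    continuous_const ⟨_, fun _ => le_rfl⟩ hv.subsolution (fun φ _ y hy => by
      have h1 : deriv φ y = 0 := by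
        have := hy.deriv_eq_zero
        rw [deriv_const_sub] at this
        linarith
      rw [hlc, h1, add_zero]
      linarith [hC y, neg_abs_le (V y)]) x
  refine abs_le.2 ⟨?_, ?_⟩
  · rw [← hlc (-C)]; gcongr
  · rw [← hlc C]; gcongr

end IsCellSolution

/-! ### One-dimensional estimates for sub- and supersolutions -/

/-- Subtracting a steep parabola centred at the midpoint forces an interior maximum, so points of
touching from above are dense. -/
theorem exists_isLocalMax_sub {f : ℝ → ℝ} (hf : Continuous f) {a b : ℝ} (hab : a < b) :
    ∃ φ : ℝ → ℝ, ContDiff ℝ 1 φ ∧ ∃ y ∈ Ioo a b, IsLocalMax (fun x => f x - φ x) y := by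
  set m := (a + b) / 2 with hm
  set M := (|f a - f m| + |f b - f m| + 1) / ((b - a) / 2) ^ 2 with hM
  have hpos : 0 < (b - a) / 2 := by linarith
  have hMval : M * ((b - a) / 2) ^ 2 = |f a - f m| + |f b - f m| + 1 := by
    rw [hM, div_mul_cancel₀ _ (by positivity)]
  obtain ⟨t, ht, hmax⟩ := (isCompact_Icc (a := a) (b := b)).exists_isMaxOn
    ⟨a, le_rfl, hab.le⟩ (f := fun x => f x - M * (x - m) ^ 2) (by fun_prop)
  have hval := hmax (show m ∈ Icc a b by constructor <;> linarith)
  simp only [mem_ofPred_eq, sub_self] at hval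
  have h1 := le_abs_self (f a - f m)
  have h2 := le_abs_self (f b - f m)
  have h3 := abs_nonneg (f a - f m)
  have h4 := abs_nonneg (f b - f m)
  have htI : t ∈ Ioo a b := by
    refine ⟨lt_of_le_of_ne ht.1 ?_, lt_of_le_of_ne ht.2 ?_⟩
    · rintro rfl
      rw [show a - m = -((b - a) / 2) by rw [hm]; ring, neg_sq, hMval] at hval
      linarith
    · rintro rfl
      rw [show t - m = (t - a) / 2 by rw [hm]; ring, hMval] at hval
      linarith
  refine ⟨fun x => M * (x - m) ^ 2, by fun_prop, t, htI, ?_⟩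
  filter_upwards [Ioo_mem_nhds htI.1 htI.2] with x hx
  exact hmax (Ioo_subset_Icc_self hx)

theorem IsViscositySubsolution.mul_le_of_lt {H V v : ℝ → ℝ} {l p κ z : ℝ}
    (hH : ∀ s, 0 ≤ H s) (hV : Continuous V) (hv : Continuous v)
    (hsub : IsViscositySubsolution H V l p v) (hz : -κ < V z) : l * v z ≤ κ := by
  by_contra! hlt
  have h1 : ∀ᶠ x in 𝓝 z, -κ < V x := (hV.tendsto z).eventually_const_lt hz
  have h2 : ∀ᶠ x in 𝓝 z, κ < l * v x :=
    ((continuous_const.mul hv).tendsto z).eventually_const_lt hlt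
  obtain ⟨a, b, hmem, hsubset⟩ := mem_nhds_iff_exists_Ioo_subset.1 (h1.and h2)
  obtain ⟨φ, hφ, y, hy, hmax⟩ := exists_isLocalMax_sub hv (hmem.1.trans hmem.2)
  have := hsub φ hφ y hmax
  obtain ⟨h3, h4⟩ := hsubset hy
  linarith [hH (p + deriv φ y)]

/-- Absorbing `p` into the unknown puts solutions for different slopes under the same Hamiltonian,
so that they can be compared. -/
theorem IsViscositySubsolution.isSubsolutionOn_linear_add {H V v : ℝ → ℝ} {l p : ℝ}
    (h : IsViscositySubsolution H V l p v) (a b : ℝ) :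
    IsSubsolutionOn H (fun x => -V x - l * v x) (fun x => p * x + v x) a b := by
  intro φ hφ y _ hy
  have h1 := h (fun x => φ x - p * x) (by fun_prop) y (hy.congr (Eventually.of_forall fun x => by
    ring))
  have h2 : deriv (fun x => φ x - p * x) y = deriv φ y - p := by
    rw [deriv_fun_sub (hφ.differentiable (by simp) y) (by fun_prop)]
    simp
  rw [h2, add_sub_cancel] at h1
  dsimp only
  linarith

theorem IsViscositySupersolution.isSupersolutionOn_linear_add {H V v : ℝ → ℝ} {l p : ℝ}
    (h : IsViscositySupersolution H V l p v) (a b : ℝ) :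
    IsSupersolutionOn H (fun x => -V x - l * v x) (fun x => p * x + v x) a b := by
  intro φ hφ y _ hy
  have h1 := h (fun x => φ x - p * x) (by fun_prop) y (hy.congr (Eventually.of_forall fun x => by
    ring))
  have h2 : deriv (fun x => φ x - p * x) y = deriv φ y - p := by
    rw [deriv_fun_sub (hφ.differentiable (by simp) y) (by fun_prop)]
    simp
  rw [h2, add_sub_cancel] at h1
  dsimp only
  linarith

/-- A supersolution of `H (w') = G` with `G` above the values of `H` on `[-c, c]` decreases at
rate at least `c / 2` away from any point, on at least one side. -/
theorem IsSupersolutionOn.decreasing_left_or_right {H G W : ℝ → ℝ} {a b c κ z : ℝ}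
    (hW : IsSupersolutionOn H G W a b) (hWc : Continuous W) (hc0 : 0 < c)
    (hc : ∀ s, |s| ≤ c → H s < κ) (hG : ∀ y ∈ Ioo a b, κ ≤ G y) :
    (∀ x ∈ Ico a z, W x < W z - c / 2 * (z - x)) ∨
      ∀ x ∈ Ioc z b, W x < W z - c / 2 * (x - z) := by
  by_contra! hcon
  obtain ⟨⟨x₁, hx₁, h₁⟩, x₂, hx₂, h₂⟩ := hcon
  -- `τ` rounds the cone `|x - z|` so little that `W + c * s` is still larger at `x₁` and `x₂` than
  -- at `z`. Its interior minimum tests `W` with a slope in `[-c, c]`, where `H < κ`.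
  set τ := min (z - x₁) (x₂ - z) / 2 with hτ
  have hd₁ : 0 < z - x₁ := sub_pos.2 hx₁.2
  have hd₂ : 0 < x₂ - z := sub_pos.2 hx₂.1
  have hτ0 : 0 < τ := by positivity
  have hτ₁ : τ ≤ (z - x₁) / 2 := by rw [hτ]; gcongr; exact min_le_left _ _
  have hτ₂ : τ ≤ (x₂ - z) / 2 := by rw [hτ]; gcongr; exact min_le_right _ _
  set s : ℝ → ℝ := fun x => √((x - z) ^ 2 + τ ^ 2) with hs
  have hscont : ContDiff ℝ 1 s := ContDiff.sqrt (by fun_prop) (fun t => by positivity)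
  have hsabs : ∀ t, |t - z| < s t := fun t => by
    rw [hs, ← Real.sqrt_sq_eq_abs]
    exact Real.sqrt_lt_sqrt (sq_nonneg _) (by linarith [sq_pos_of_pos hτ0])
  have hsz : s z = τ := by simp [hs, hτ0.le]
  have hsderiv : ∀ t, |deriv s t| ≤ 1 := by
    intro t
    have h1 : HasDerivAt (fun t : ℝ => (t - z) ^ 2 + τ ^ 2) (2 * (t - z)) t := by
      simpa using (((hasDerivAt_id t).sub_const z).pow 2).add_const (τ ^ 2)
    have h2 := h1.sqrt (by positivity)
    have hpos : 0 < √((t - z) ^ 2 + τ ^ 2) := Real.sqrt_pos.2 (by positivity)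
    rw [hs, h2.deriv, abs_div, abs_of_pos (by positivity : 0 < 2 * √((t - z) ^ 2 + τ ^ 2)),
      div_le_one (by positivity), abs_mul, abs_two]
    have := (hsabs t).le
    rw [hs] at this
    linarith
  obtain ⟨t, ht, hmin⟩ := (isCompact_Icc (a := x₁) (b := x₂)).exists_isMinOn
    ⟨z, hx₁.2.le, hx₂.1.le⟩ (f := fun x => W x - -c * s x)
    (by have := hscont.continuous; fun_prop)
  have hval := hmin (show z ∈ Icc x₁ x₂ from ⟨hx₁.2.le, hx₂.1.le⟩)
  simp only [mem_ofPred_eq, hsz] at hval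
  have hst := hsabs t
  have htI : t ∈ Ioo x₁ x₂ := by
    refine ⟨lt_of_le_of_ne ht.1 ?_, lt_of_le_of_ne ht.2 ?_⟩
    · rintro rfl
      rw [abs_sub_comm, abs_of_pos hd₁] at hst
      nlinarith
    · rintro rfl
      rw [abs_of_pos hd₂] at hst
      nlinarith
  have hty : t ∈ Ioo a b := ⟨hx₁.1.trans_lt htI.1, htI.2.trans_le hx₂.2⟩
  have htest := hW (fun x => -c * s x) (contDiff_const.mul hscont) t hty (by
    filter_upwards [Ioo_mem_nhds htI.1 htI.2] with x hx
    exact hmin (Ioo_subset_Icc_self hx))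
  rw [deriv_const_mul_field] at htest
  have := hc (-c * deriv s t) (by
    rw [abs_mul, abs_neg, abs_of_pos hc0]
    nlinarith [hsderiv t])
  linarith [hG t hty]

/-- A parabola based at `x` has slope above `s` to the right of `x`, so it cannot touch `U` in the
interior; `M` is large enough to exclude the right end, and the maximum is at `x`. -/
theorem exists_le_add_quadratic {U : ℝ → ℝ} {s r z : ℝ} (hU : Continuous U) (hs : 0 < s)
    (hr : 0 < r)
    (h : ∀ φ : ℝ → ℝ, ContDiff ℝ 1 φ → ∀ y ∈ Ioo (z - r) (z + r),
      IsLocalMax (fun x => U x - φ x) y → deriv φ y < s) :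
    ∃ M : ℝ, 0 < M ∧ ∀ x ∈ Ioc (z - r) z, U z ≤ U x + s * (z - x) + M * (z - x) ^ 2 := by
  obtain ⟨B, hB⟩ := (isCompact_Icc (a := z - r) (b := z + r)).exists_bound_of_continuousOn
    hU.continuousOn
  simp only [Real.norm_eq_abs] at hB
  have hB0 : 0 ≤ B := (abs_nonneg _).trans (hB z ⟨by linarith, by linarith⟩)
  refine ⟨(2 * B + 1) / r ^ 2, by positivity, fun x hx => ?_⟩
  set M := (2 * B + 1) / r ^ 2 with hM
  have hMr : M * r ^ 2 = 2 * B + 1 := by rw [hM]; field_simp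
  have hM0 : 0 < M := by positivity
  obtain ⟨t, ht, hmax⟩ := (isCompact_Icc (a := x) (b := z + r)).exists_isMaxOn
    ⟨x, le_rfl, by linarith [hx.2]⟩ (f := fun t => U t - (s * (t - x) + M * (t - x) ^ 2))
    (by fun_prop)
  have hval := hmax (show x ∈ Icc x (z + r) from ⟨le_rfl, by linarith [hx.2]⟩)
  simp only [mem_ofPred_eq, sub_self] at hval
  have htr : t ≠ z + r := by
    rintro rfl
    have h1 := (abs_le.1 (hB (z + r) ⟨by linarith, le_rfl⟩)).2
    have h2 := (abs_le.1 (hB x ⟨hx.1.le, by linarith [hx.2]⟩)).1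
    have h3 : M * r ^ 2 ≤ M * (z + r - x) ^ 2 := by gcongr; linarith [hx.2]
    have h4 : 0 ≤ s * (z + r - x) := by have : 0 ≤ z + r - x := by linarith [hx.2]
                                        positivity
    nlinarith
  have htx : t = x := by
    by_contra hne
    have hxt : x < t := lt_of_le_of_ne ht.1 (Ne.symm hne)
    have hd : HasDerivAt (fun t => s * (t - x) + M * (t - x) ^ 2) (s + M * (2 * (t - x))) t := by
      simpa using (((hasDerivAt_id t).sub_const x).const_mul s).fun_add
        ((((hasDerivAt_id t).sub_const x).pow 2).const_mul M)
    have := h (fun t => s * (t - x) + M * (t - x) ^ 2) (by fun_prop) t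
      ⟨hx.1.trans hxt, lt_of_le_of_ne ht.2 htr⟩ (by
        filter_upwards [Ioo_mem_nhds hxt (lt_of_le_of_ne ht.2 htr)] with y hy
        exact hmax (Ioo_subset_Icc_self hy))
    rw [hd.deriv] at this
    have h5 : 0 < M * (2 * (t - x)) := by
      have := sub_pos.2 hxt
      positivity
    linarith
  have h6 := hmax (show z ∈ Icc x (z + r) from ⟨hx.2, by linarith⟩)
  simp only [mem_ofPred_eq, htx, sub_self] at h6
  linarith

/-- The first exit of a continuous function from a sublevel set, to the left of `z`. -/
theorem exists_left_exit {f : ℝ → ℝ} (hf : Continuous f) {A κ z : ℝ} (hA : A < z) (hz : f z < κ) :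
    ∃ a, A ≤ a ∧ a < z ∧ (a = A ∨ κ ≤ f a) ∧ ∀ x ∈ Ioc a z, f x < κ := by
  have hcomp : IsCompact (Icc A z ∩ ({A} ∪ {x | κ ≤ f x})) :=
    isCompact_Icc.inter_right (isClosed_singleton.union (isClosed_le continuous_const hf))
  obtain ⟨a, ⟨ha, ha'⟩, hgr⟩ := hcomp.exists_isGreatest ⟨A, ⟨le_rfl, hA.le⟩, Or.inl rfl⟩
  refine ⟨a, ha.1, lt_of_le_of_ne ha.2 ?_, ha', fun x hx => ?_⟩
  · rintro rfl
    rcases ha' with h | h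
    · exact hA.ne' h
    · exact absurd h (not_le.2 hz)
  · by_contra! hcon
    exact absurd (hgr ⟨⟨ha.1.trans hx.1.le, hx.2⟩, Or.inr hcon⟩) (not_le.2 hx.1)

theorem exists_right_exit {f : ℝ → ℝ} (hf : Continuous f) {A κ z : ℝ} (hA : z < A) (hz : f z < κ) :
    ∃ b, z < b ∧ b ≤ A ∧ (b = A ∨ κ ≤ f b) ∧ ∀ x ∈ Ico z b, f x < κ := by
  obtain ⟨a, h1, h2, h3, h4⟩ := exists_left_exit (f := fun x => f (-x)) (hf.comp continuous_neg)
    (neg_lt_neg hA) (show f (- -z) < κ by rwa [neg_neg])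
  refine ⟨-a, by linarith, by linarith, h3.imp (fun h => by rw [h, neg_neg]) id, fun x hx => ?_⟩
  simpa using h4 (-x) ⟨by linarith [hx.2], by linarith [hx.1]⟩

/-! ### The lower bound -/

/-- If the solution `u` at `q` is almost null on `[-A, A]`, then the solution `v` at `p ∈ [0, q)`
is not very negative at points where the potential almost attains its supremum. -/
theorem IsCellSolution.le_mul_of_pos {H V u v : ℝ → ℝ} {l p q c κ ε C A z : ℝ}
    (hV : Continuous V) (hV0 : ∀ x, V x ≤ 0) (hl : 0 < l)
    (hu : IsCellSolution H V l q u) (hv : IsCellSolution H V l p v) (hp : 0 ≤ p) (hpq : p < q)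
    (hc0 : 0 < c) (hc : ∀ s, |s| ≤ c → H s < κ) (hε : ∀ s, H s < 2 * ε → |s| < c / 4)
    (hε0 : 0 < ε) (hεκ : ε < κ)
    (huA : ∀ x ∈ Icc (-A) A, |l * u x| ≤ ε) (hvC : ∀ x, -C ≤ l * v x) (hz : -ε < V z)
    (hzA : -A < z) (hzA' : z < A)
    (hright : C < c / 2 * (l * (A - z))) (hleft : C < (q - p) * (l * (z + A))) :
    -κ - 2 * ε ≤ l * v z := by
  by_contra! hlt
  have hvc := hv.continuous
  have huc := hu.continuous
  have hlvc : Continuous fun x => l * v x := continuous_const.mul hvc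
  obtain ⟨a, haA, haz, ha, hav⟩ := exists_left_exit hlvc hzA (κ := -κ) (by linarith)
  obtain ⟨b, hzb, hbA, hb, hbv⟩ := exists_right_exit hlvc hzA' (κ := -κ) (by linarith)
  have hJ : ∀ x ∈ Ioo a b, l * v x < -κ := by
    intro x hx
    rcases le_total x z with h | h
    · exact hav x ⟨hx.1, h⟩
    · exact hbv x ⟨h, hx.2⟩
  set W : ℝ → ℝ := fun x => p * x + v x with hW
  set U : ℝ → ℝ := fun x => q * x + u x with hU
  have hWc : Continuous W := by fun_prop
  have hUc : Continuous U := by fun_prop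
  rcases (hv.supersolution.isSupersolutionOn_linear_add a b).decreasing_left_or_right (z := z)
    hWc hc0 hc (fun y hy => by linarith [hJ y hy, hV0 y]) with hL | hR
  · have hUsub := hu.subsolution.isSubsolutionOn_linear_add
    have hVz : ∀ᶠ x in 𝓝 z, -ε < V x := (hV.tendsto z).eventually_const_lt hz
    obtain ⟨r₁, hr₁, hball⟩ := Metric.eventually_nhds_iff.1 hVz
    set r := min r₁ (min (z + A) (A - z)) with hr
    have hr0 : 0 < r := by
      have h1 : 0 < z + A := by linarith
      have h2 : 0 < A - z := by linarith
      positivity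
    have hrA : r ≤ z + A := (min_le_right _ _).trans (min_le_left _ _)
    have hrA' : r ≤ A - z := (min_le_right _ _).trans (min_le_right _ _)
    obtain ⟨M, hM0, hM⟩ := exists_le_add_quadratic (z := z) hUc (show 0 < c / 4 by positivity) hr0
      (fun φ hφ y hy hmax => by
        have h1 := hUsub (z - r) (z + r) φ hφ y hy hmax
        have h2 : -ε < V y := hball (by
          rw [Real.dist_eq]
          exact (abs_lt.2 ⟨by linarith [hy.1], by linarith [hy.2]⟩).trans_le (min_le_left _ _))
        have h3 := (abs_le.1 (huA y ⟨by linarith [hy.1], by linarith [hy.2]⟩)).1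
        exact (le_abs_self _).trans_lt (hε _ (by linarith)))
    obtain ⟨d, hd0, hd⟩ := exists_between
      (show 0 < min r (min (c / (4 * M)) (z - a)) by
        have := sub_pos.2 haz
        positivity)
    have hdr : d < r := hd.trans_le (min_le_left _ _)
    have hdc : d < c / (4 * M) := hd.trans_le ((min_le_right _ _).trans (min_le_left _ _))
    have hda : d < z - a := hd.trans_le ((min_le_right _ _).trans (min_le_right _ _))
    have hMd : M * d < c / 4 := by
      rw [lt_div_iff₀ (by positivity)] at hdc
      linarith
    -- Between `z - d` and `z`, `W` gains more than `c / 2 * d`, while `U` gains at most `(c / 4 + M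
    -- * d) * d`, which is less.
    have hDm : W (z - d) - U (z - d) < W z - U z := by
      have h1 := hL (z - d) ⟨by linarith, by linarith⟩
      have h2 := hM (z - d) ⟨by linarith, by linarith⟩
      rw [sub_sub_cancel] at h1 h2
      nlinarith
    -- Otherwise `W - U` dips inside `(a, z)`, and doubling gives `l * u x ≤ l * v x < -κ`, against
    -- `l * u x ≥ -ε`.
    have hDa : W a - U a < W z - U z := by
      by_contra! hge
      obtain ⟨x, hx, -, hxle⟩ := exists_isMinOn_sub_and_le (m := z - d) (by fun_prop)
        (by fun_prop) hUc hWc (hUsub a z)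
        (hv.supersolution.isSupersolutionOn_linear_add a z) ⟨by linarith, by linarith⟩
        (hDm.trans_le hge) hDm
      have h1 := hJ x ⟨hx.1, hx.2.trans hzb⟩
      have h2 := (abs_le.1 (huA x ⟨by linarith [hx.1], by linarith [hx.2]⟩)).1
      linarith
    have h1 := (abs_le.1 (huA a ⟨haA, by linarith⟩)).2
    have h2 := (abs_le.1 (huA z ⟨hzA.le, hzA'.le⟩)).1
    have h3 : l * (W a - U a) < l * (W z - U z) := by gcongr
    have h4 : l * v a < l * v z + 2 * ε - (q - p) * (l * (z - a)) := by
      simp only [hW, hU] at h3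
      linarith
    have h5 : 0 ≤ (q - p) * (l * (z - a)) := by
      have := sub_pos.2 haz
      have := sub_pos.2 hpq
      positivity
    -- Either the end `-A` is reached and the drop exceeds the bound `C`, or `l * v a ≥ -κ` is
    -- violated.
    rcases ha with rfl | ha
    · rw [sub_neg_eq_add] at h4
      linarith [hvC (-A)]
    · linarith
  · have h1 := hR b ⟨hzb, le_rfl⟩
    have h2 : l * W b < l * (W z - c / 2 * (b - z)) := by gcongr
    have h3 : 0 ≤ p * (l * (b - z)) := by
      have := sub_pos.2 hzb
      positivity
    have h4 : l * v b < l * v z - c / 2 * (l * (b - z)) := by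
      simp only [hW] at h2
      linarith
    have h5 : 0 ≤ c / 2 * (l * (b - z)) := by
      have := sub_pos.2 hzb
      positivity
    rcases hb with rfl | hb
    · linarith [hvC b]
    · linarith

/-! ### Reflection and positivity of the Hamiltonian -/

/-- Reduces negative `q` to positive `q`. -/
theorem IsCellSolution.reflect {H V v : ℝ → ℝ} {l p : ℝ} (h : IsCellSolution H V l p v) :
    IsCellSolution (fun s => H (-s)) (fun x => V (-x)) l (-p) (fun x => v (-x)) := by
  have htest : ∀ (φ : ℝ → ℝ) (y : ℝ), -(-p + deriv φ y) = p + deriv (fun x => φ (-x)) (-y) := by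
    intro φ y
    rw [deriv_comp_neg, neg_neg]
    ring
  refine ⟨h.continuous.comp continuous_neg, h.bounded.imp fun C hC x => hC _, ?_, ?_⟩
  · intro φ hφ y hy
    dsimp only
    rw [htest]
    refine h.subsolution _ (hφ.comp contDiff_neg) (-y) ?_
    have h1 : Tendsto (fun x : ℝ => -x) (𝓝 (-y)) (𝓝 y) := by
      simpa using (continuous_neg (G := ℝ)).tendsto (-y)
    filter_upwards [h1.eventually hy] with x hx
    simpa using hx
  · intro φ hφ y hy
    dsimp only
    rw [htest]
    refine h.supersolution _ (hφ.comp contDiff_neg) (-y) ?_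
    have h1 : Tendsto (fun x : ℝ => -x) (𝓝 (-y)) (𝓝 y) := by
      simpa using (continuous_neg (G := ℝ)).tendsto (-y)
    filter_upwards [h1.eventually hy] with x hx
    simpa using hx

/-- Points where `V` is close to `0` are found at distance `o(N)` of every point of `[-N, N]`. -/
def HasSublinearGaps (V : ℝ → ℝ) : Prop :=
  ∀ ε : ℝ, 0 < ε → ∀ δ : ℝ, 0 < δ → ∃ N₀ : ℝ, ∀ N, N₀ ≤ N → ∀ y, |y| ≤ N →
    ∃ z, |z - y| ≤ δ * N ∧ -ε < V z

theorem HasSublinearGaps.reflect {V : ℝ → ℝ} (h : HasSublinearGaps V) :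
    HasSublinearGaps fun x => V (-x) := by
  intro ε hε δ hδ
  obtain ⟨N₀, hN₀⟩ := h ε hε δ hδ
  refine ⟨N₀, fun N hN y hy => ?_⟩
  obtain ⟨z, hz, hVz⟩ := hN₀ N hN (-y) (by rwa [abs_neg])
  refine ⟨-z, ?_, by simpa using hVz⟩
  rwa [show -z - y = -(z - -y) by ring, abs_neg]

/-- On each monotone piece `H` is smallest at a turning point, where it is positive, except on the
last piece, which rises strictly from `H 0 = 0`. -/
theorem HasFiniteWellsRight.pos {H : ℝ → ℝ} (h : HasFiniteWellsRight H) (h0 : H 0 = 0) {x : ℝ}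
    (hx : 0 < x) : 0 < H x := by
  obtain ⟨L, p, hp, hlast, hmono, hinc, hdec, -, hpos⟩ := h
  have key : ∀ i, i ≤ 2 * L → ∀ x, 0 < x → p (i + 1) ≤ x → 0 < H x := by
    intro i
    induction i with
    | zero =>
      intro _ x hx hpx
      rw [zero_add] at hpx
      rcases Nat.eq_zero_or_pos L with rfl | hL
      · simp only [mul_zero, zero_add] at hlast
        have := hmono (show (0 : ℝ) ∈ Ici (p 1) from hlast.le) hpx hx
        rwa [h0] at this
      · exact (hpos 1 (mem_Icc.2 ⟨le_rfl, by lia⟩)).trans_le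
          (hmono.monotoneOn self_mem_Ici hpx hpx)
    | succ i ih =>
      intro hi x hx hpx
      rcases le_or_gt (p (i + 1)) x with hle | hlt
      · exact ih (by lia) x hx hle
      rcases Nat.even_or_odd' i with ⟨k, rfl | rfl⟩
      · have h1 := hdec (k + 1) ⟨by lia, by lia⟩
        rw [show 2 * (k + 1) = 2 * k + 1 + 1 by ring, Nat.add_sub_cancel] at h1
        have h2 := h1.antitoneOn ⟨hpx, hlt.le⟩ ⟨hpx.trans hlt.le, le_rfl⟩ hlt.le
        exact (hpos (2 * k + 1) ⟨by lia, by lia⟩).trans_le h2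
      · have h1 := hinc (k + 1) ⟨by lia, by lia⟩
        rw [show 2 * (k + 1) = 2 * k + 1 + 1 by ring] at h1
        rcases eq_or_lt_of_le hi with heq | hlt'
        · rw [heq] at hlt
          rw [heq, hlast] at h1
          have h2 := h1 ⟨le_rfl, hx.le.trans hlt.le⟩ ⟨hx.le, hlt.le⟩ hx
          rwa [h0] at h2
        · have h2 := h1.monotoneOn ⟨le_rfl, hpx.trans hlt.le⟩ ⟨hpx, hlt.le⟩ hpx
          exact (hpos _ ⟨by lia, by lia⟩).trans_le h2
  rcases le_or_gt (p (2 * L + 1)) x with h | h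
  · exact key (2 * L) le_rfl x hx h
  · rw [hlast] at h
    exact absurd h (not_lt.2 hx.le)

theorem HasFiniteWellsLeft.reflect {H : ℝ → ℝ} (h : HasFiniteWellsLeft H) :
    HasFiniteWellsRight fun s => H (-s) := by
  obtain ⟨L, p, hp, hlast, hmono, hinc, hdec, hinj, hpos⟩ := h
  refine ⟨L, fun i => -p i, fun i hi => neg_lt_neg (hp i hi), by simp [hlast], ?_, ?_, ?_,
    by simpa using hinj, by simpa using hpos⟩
  · intro x hx y hy hxy
    exact hmono (mem_Iic.2 (neg_le.1 hy)) (mem_Iic.2 (neg_le.1 hx)) (neg_lt_neg hxy)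
  · intro k hk x hx y hy hxy
    exact hinc k hk ⟨le_neg.1 hy.2, neg_le.1 hy.1⟩ ⟨le_neg.1 hx.2, neg_le.1 hx.1⟩
      (neg_lt_neg hxy)
  · intro k hk x hx y hy hxy
    exact hdec k hk ⟨le_neg.1 hy.2, neg_le.1 hy.1⟩ ⟨le_neg.1 hx.2, neg_le.1 hx.1⟩
      (neg_lt_neg hxy)

theorem exists_forall_lt_imp_abs_lt {H : ℝ → ℝ} (hH : Continuous H)
    (hcoer : Tendsto H (cocompact ℝ) atTop) (hpos : ∀ s, s ≠ 0 → 0 < H s) {c : ℝ} (hc : 0 < c) :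
    ∃ η : ℝ, 0 < η ∧ ∀ s, H s < η → |s| < c := by
  obtain ⟨Λ, hΛ, hb⟩ := exists_forall_le_imp_abs_lt hcoer 0 1
  have hcomp : IsCompact (Icc (-Λ) Λ ∩ {s | c ≤ |s|}) :=
    isCompact_Icc.inter_right (isClosed_le continuous_const continuous_abs)
  obtain ⟨η, hη, hle⟩ := hcomp.exists_forall_le' hH.continuousOn (a := 0) (fun s hs => hpos s
    (abs_pos.1 (hc.trans_le hs.2)))
  refine ⟨min η 1, by positivity, fun s hs => ?_⟩
  by_contra! hcs
  have h1 := hb s (by rw [zero_add]; exact (hs.trans_le (min_le_right _ _)).le)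
  exact absurd (hs.trans_le (min_le_left _ _)) (not_lt.2 (hle s ⟨abs_le.1 h1.le, hcs⟩))

/-! ### Passage to the macroscopic scale -/

/-- `l * v l` tends to `0` as `l → 0+`, uniformly on the intervals `[-R / l, R / l]`. -/
def IsMacroscopicallyNull (v : ℝ → ℝ → ℝ) : Prop :=
  ∀ R : ℝ, 0 < R → ∀ κ : ℝ, 0 < κ → ∀ᶠ l in 𝓝[>] (0 : ℝ),
    ∀ y ∈ Icc (-(R / l)) (R / l), |l * v l y| ≤ κ

theorem IsMacroscopicallyNull.reflect {v : ℝ → ℝ → ℝ} (h : IsMacroscopicallyNull v) :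
    IsMacroscopicallyNull fun l x => v l (-x) := by
  intro R hR κ hκ
  filter_upwards [h R hR κ hκ] with l hl y hy
  exact hl (-y) ⟨neg_le_neg hy.2, neg_le.1 hy.1⟩

/-- Continuity bounds the image of the compact interval; on an unbounded set `sSup` would take a
default value. The `+ 0` is the effective value. -/
theorem tendsto_sSup_iff_eventually {v : ℝ → ℝ → ℝ} (hv : ∀ l, 0 < l → Continuous (v l)) {R : ℝ}
    (hR : 0 < R) :
    Tendsto (fun l : ℝ => sSup ((fun y => |l * v l y + 0|) '' Icc (-(R / l)) (R / l)))
      (𝓝[>] 0) (𝓝 0) ↔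
    ∀ κ : ℝ, 0 < κ → ∀ᶠ l in 𝓝[>] (0 : ℝ), ∀ y ∈ Icc (-(R / l)) (R / l), |l * v l y| ≤ κ := by
  simp only [add_zero]
  have hmem : ∀ l : ℝ, 0 < l → (0 : ℝ) ∈ Icc (-(R / l)) (R / l) := fun l hl => by
    have : 0 < R / l := by positivity
    constructor <;> linarith
  have hbdd : ∀ l : ℝ, 0 < l →
      BddAbove ((fun y => |l * v l y|) '' Icc (-(R / l)) (R / l)) := fun l hl =>
    (isCompact_Icc.image (continuous_const.mul (hv l hl)).abs).bddAbove
  constructor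
  · intro h κ hκ
    filter_upwards [h.eventually_lt_const hκ, self_mem_nhdsWithin] with l hl hl0 y hy
    exact (le_csSup (hbdd l hl0) ⟨y, hy, rfl⟩).trans hl.le
  · intro h
    rw [Metric.tendsto_nhds]
    intro κ hκ
    filter_upwards [h (κ / 2) (by positivity), self_mem_nhdsWithin] with l hl hl0
    rw [Real.dist_eq, sub_zero]
    have h1 : sSup ((fun y => |l * v l y|) '' Icc (-(R / l)) (R / l)) ≤ κ / 2 :=
      csSup_le ⟨_, 0, hmem l hl0, rfl⟩ (by rintro _ ⟨y, hy, rfl⟩; exact hl y hy)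
    have h2 : 0 ≤ sSup ((fun y => |l * v l y|) '' Icc (-(R / l)) (R / l)) :=
      (abs_nonneg _).trans (le_csSup (hbdd l hl0) ⟨0, hmem l hl0, rfl⟩)
    rw [abs_of_nonneg h2]
    linarith

theorem IsMacroscopicallyNull.of_pos {H V : ℝ → ℝ} {u v : ℝ → ℝ → ℝ} {p q : ℝ} {K : NNReal}
    (hH : LipschitzWith K H) (hcoer : Tendsto H (cocompact ℝ) atTop) (hH0 : H 0 = 0)
    (hpos : ∀ s, s ≠ 0 → 0 < H s) (hV : Continuous V) (hVb : ∃ C, ∀ x, |V x| ≤ C)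
    (hV0 : ∀ x, V x ≤ 0) (hgaps : HasSublinearGaps V) (hp : 0 ≤ p) (hpq : p < q)
    (hu : ∀ l, 0 < l → IsCellSolution H V l q (u l))
    (hv : ∀ l, 0 < l → IsCellSolution H V l p (v l))
    (hnull : IsMacroscopicallyNull u) : IsMacroscopicallyNull v := by
  have hHnn : ∀ s, 0 ≤ H s := fun s => by
    rcases eq_or_ne s 0 with rfl | h
    · exact hH0.ge
    · exact (hpos s h).le
  obtain ⟨C₀, hC₀⟩ := hVb
  set C := C₀ + H p with hC
  have hVC : ∀ x, |V x| + H p ≤ C := fun x => by linarith [hC₀ x]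
  have hC0 : 0 ≤ C := by linarith [hVC 0, abs_nonneg (V 0), hHnn p]
  obtain ⟨Λ, hΛ0, hΛ⟩ := exists_forall_le_imp_abs_lt hcoer p (2 * C)
  have hvC : ∀ l, 0 < l → ∀ x, |l * v l x| ≤ C := fun l hl x =>
    (hv l hl).abs_mul_le hH (hHnn p) hV hl hVC x
  have hlip : ∀ l, 0 < l → ∀ x y, |v l x - v l y| ≤ Λ * |x - y| := fun l hl =>
    abs_sub_le_of_forall_isLocalMax (hv l hl).continuous (hv l hl).bounded hΛ0
      ((hv l hl).subsolution.abs_slope_lt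
        (fun x => by linarith [hVC x, neg_abs_le (V x), hHnn p])
        (fun x => (abs_le.1 (hvC l hl x)).1) hΛ)
  intro R hR κ hκ
  have hκ' : 0 < κ / 4 := by positivity
  obtain ⟨c₁, hc₁, hball⟩ := Metric.eventually_nhds_iff.1
    ((hH.continuous.tendsto 0).eventually_lt_const (show H 0 < κ / 4 by rwa [hH0]))
  set c := c₁ / 2 with hc
  have hc0 : 0 < c := by positivity
  have hcκ : ∀ s, |s| ≤ c → H s < κ / 4 := fun s hs => hball (by
    rw [Real.dist_eq, sub_zero]; linarith)
  obtain ⟨η, hη, hηc⟩ := exists_forall_lt_imp_abs_lt hH.continuous hcoer hpos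
    (show 0 < c / 4 by positivity)
  -- `2 * ε ≤ η` makes `H s < 2 * ε` force `|s| < c / 4`; `ε ≤ κ / 8` keeps the lower bound at `z`
  -- above `-κ / 2`.
  set ε := min (η / 2) (κ / 8) with hε
  have hε0 : 0 < ε := by positivity
  have hεη : ε ≤ η / 2 := min_le_left _ _
  have hεκ : ε ≤ κ / 8 := min_le_right _ _
  set s := min (c / 2) (q - p) with hs
  have hs0 : 0 < s := by
    have := sub_pos.2 hpq
    positivity
  -- Since `|l * z| ≤ R + 1`, a margin of at least `C / s + 1` remains on both sides, over which a
  -- drop at rate `s` exceeds `C`.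
  set R' := R + C / s + 2 with hR'
  have hR'0 : 0 < R' := by positivity
  set d := min 1 (κ / (4 * Λ)) with hd
  have hd0 : 0 < d := by positivity
  have hd1 : d ≤ 1 := min_le_left _ _
  have hdΛ : Λ * d ≤ κ / 4 := by
    calc Λ * d ≤ Λ * (κ / (4 * Λ)) := by gcongr; exact min_le_right _ _
      _ = κ / 4 := by field_simp
  -- Applied with `N = R / l`, this gives gaps `d / l`, hence an error at most `Λ * d ≤ κ / 4` in `l
  -- * v`.
  obtain ⟨N₀, hN₀⟩ := hgaps ε hε0 (d / R) (by positivity)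
  have hlarge : ∀ᶠ l in 𝓝[>] (0 : ℝ), N₀ ≤ R / l := by
    have : Tendsto (fun l : ℝ => R / l) (𝓝[>] 0) atTop := by
      simpa only [div_eq_mul_inv] using tendsto_inv_nhdsGT_zero.const_mul_atTop hR
    exact this.eventually_ge_atTop N₀
  filter_upwards [hnull R' hR'0 ε hε0, hlarge, self_mem_nhdsWithin] with l hul hlN hl y hy
  have hl : 0 < l := hl
  obtain ⟨z, hzy, hVz⟩ := hN₀ _ hlN y (abs_le.2 hy)
  have hzy' : l * |z - y| ≤ d := by
    calc l * |z - y| ≤ l * (d / R * (R / l)) := by gcongr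
      _ = d := by field_simp
  have hly : |l * y| ≤ R := by
    rw [abs_mul, abs_of_pos hl]
    calc l * |y| ≤ l * (R / l) := by gcongr; exact abs_le.2 hy
      _ = R := by field_simp
  have hlzy : |l * (z - y)| ≤ d := by rwa [abs_mul, abs_of_pos hl]
  have hlA : l * (R' / l) = R' := by field_simp
  have hlzy2 := abs_le.1 hlzy
  have hly2 := abs_le.1 hly
  have hCs : C < s * (C / s + 1) := by
    have : s * (C / s) = C := by field_simp
    nlinarith
  have hCs0 : 0 ≤ C / s + 1 := by positivity
  have hlow : -(κ / 4) - 2 * ε ≤ l * v l z := by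
    refine (hu l hl).le_mul_of_pos (C := C) (A := R' / l) hV hV0 hl (hv l hl) hp hpq hc0 hcκ
      (fun s hs => hηc s (by linarith)) hε0 (by linarith) hul
      (fun x => (abs_le.1 (hvC l hl x)).1) hVz ?_ ?_ ?_ ?_
    · refine lt_of_mul_lt_mul_left ?_ hl.le
      rw [mul_neg, hlA]
      have : 0 ≤ C / s := by positivity
      linarith
    · refine lt_of_mul_lt_mul_left ?_ hl.le
      rw [hlA]
      have : 0 ≤ C / s := by positivity
      linarith
    · refine hCs.trans_le ?_
      have h1 : C / s + 1 ≤ l * (R' / l - z) := by rw [mul_sub, hlA]; linarith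
      exact mul_le_mul (min_le_left _ _) h1 hCs0 (by positivity)
    · refine hCs.trans_le ?_
      have h1 : C / s + 1 ≤ l * (z + R' / l) := by rw [mul_add, hlA]; linarith
      exact mul_le_mul (min_le_right _ _) h1 hCs0 (by linarith)
  have hup : l * v l z ≤ ε :=
    (hv l hl).subsolution.mul_le_of_lt hHnn hV (hv l hl).continuous hVz
  have hdiff : |l * v l z - l * v l y| ≤ κ / 4 := by
    rw [← mul_sub, abs_mul, abs_of_pos hl]
    calc l * |v l z - v l y| ≤ l * (Λ * |z - y|) := by gcongr; exact hlip l hl z y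
      _ = Λ * (l * |z - y|) := by ring
      _ ≤ Λ * d := by gcongr
      _ ≤ κ / 4 := hdΛ
  have hdiff2 := abs_le.1 hdiff
  rw [abs_le]
  constructor <;> linarith

/-- If the solutions at `q` are macroscopically null, then so are the solutions at every `p`
between `0` and `q`. -/
theorem IsMacroscopicallyNull.of_mem_segment {H V : ℝ → ℝ} {u v : ℝ → ℝ → ℝ} {p q : ℝ}
    {K : NNReal} (hH : LipschitzWith K H) (hcoer : Tendsto H (cocompact ℝ) atTop) (hH0 : H 0 = 0)
    (hpos : ∀ s, s ≠ 0 → 0 < H s) (hV : Continuous V) (hVb : ∃ C, ∀ x, |V x| ≤ C)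
    (hV0 : ∀ x, V x ≤ 0) (hgaps : HasSublinearGaps V) (hp : p ∈ segment ℝ 0 q)
    (hu : ∀ l, 0 < l → IsCellSolution H V l q (u l))
    (hv : ∀ l, 0 < l → IsCellSolution H V l p (v l))
    (hnull : IsMacroscopicallyNull u) : IsMacroscopicallyNull v := by
  rw [segment_eq_uIcc] at hp
  rcases eq_or_ne p q with rfl | hne
  · intro R hR κ hκ
    filter_upwards [hnull R hR κ hκ, self_mem_nhdsWithin] with l hl hl0
    rwa [(hv l hl0).unique hH hV hl0 (hu l hl0)]
  rcases le_total 0 q with hq | hq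
  · rw [uIcc_of_le hq] at hp
    exact .of_pos hH hcoer hH0 hpos hV hVb hV0 hgaps hp.1 (lt_of_le_of_ne hp.2 hne) hu hv hnull
  · rw [uIcc_of_ge hq] at hp
    have hneg : LipschitzWith K fun s => H (-s) := LipschitzWith.of_dist_le_mul fun x y => by
      simpa using hH.dist_le_mul (-x) (-y)
    have := IsMacroscopicallyNull.of_pos hneg
      (hcoer.comp (Homeomorph.neg ℝ).isClosedEmbedding.tendsto_cocompact) (by simpa using hH0)
      (fun s hs => hpos _ (neg_ne_zero.2 hs)) (hV.comp continuous_neg)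
      (hVb.imp fun C hC x => hC _) (fun x => hV0 _) hgaps.reflect (neg_nonneg.2 hp.2)
      (neg_lt_neg (lt_of_le_of_ne hp.1 hne.symm)) (fun l hl => (hu l hl).reflect)
      (fun l hl => (hv l hl).reflect) hnull.reflect
    simpa using this.reflect

/-! ### The maximal ergodic inequality -/

/-- The covering argument behind the maximal inequality. -/
theorem mul_sum_range_le_sum_range {α : ℝ} (hα : 0 ≤ α) {N : ℕ} (T : ℕ) :
    ∀ g b : ℕ → ℝ, (∀ i, 0 ≤ g i) → (∀ k, b k ≤ 1) →
      (∀ k, b k ≤ 0 ∨ ∃ n, 1 ≤ n ∧ n ≤ N ∧ α * n ≤ ∑ i ∈ Finset.range n, g (k + i)) →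
      α * ∑ k ∈ Finset.range T, b k ≤ ∑ i ∈ Finset.range (T + N), g i := by
  induction T using Nat.strong_induction_on with
  | _ T ih =>
    intro g b hg hb1 hb
    -- Greedy covering: remove an initial block on which the estimate holds, either one bad index or
    -- a whole good run, and recurse on the rest.
    have hshift : ∀ n T', 1 ≤ n → T = n + T' →
        α * ∑ k ∈ Finset.range n, b k ≤ ∑ i ∈ Finset.range n, g i →
        α * ∑ k ∈ Finset.range T, b k ≤ ∑ i ∈ Finset.range (T + N), g i := by
      intro n T' hn hT hle
      have h1 := ih T' (by lia) (fun i => g (n + i)) (fun i => b (n + i)) (fun i => hg _)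
        (fun k => hb1 _) (fun k => by simpa only [add_assoc] using hb (n + k))
      rw [hT, add_assoc, Finset.sum_range_add, Finset.sum_range_add, mul_add]
      exact add_le_add hle h1
    rcases Nat.eq_zero_or_pos T with rfl | hT
    · simpa using Finset.sum_nonneg fun i _ => hg i
    rcases hb 0 with h0 | ⟨n, hn1, hnN, hn⟩
    · refine hshift 1 (T - 1) le_rfl (by lia) ?_
      simp only [Finset.range_one, Finset.sum_singleton]
      exact (mul_nonpos_of_nonneg_of_nonpos hα h0).trans (hg 0)
    · simp only [zero_add] at hn
      have hbsum : ∀ m : ℕ, α * ∑ k ∈ Finset.range m, b k ≤ α * m := fun m => by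
        gcongr
        simpa using Finset.sum_le_card_nsmul (Finset.range m) b 1 fun k _ => hb1 k
      rcases le_or_gt T n with hTn | hTn
      · calc α * ∑ k ∈ Finset.range T, b k ≤ α * T := hbsum T
          _ ≤ α * n := by gcongr
          _ ≤ ∑ i ∈ Finset.range n, g i := hn
          _ ≤ ∑ i ∈ Finset.range (T + N), g i :=
            Finset.sum_le_sum_of_subset_of_nonneg (Finset.range_mono (by lia))
              fun i _ _ => hg i
      · exact hshift n (T - n) hn1 (by lia) ((hbsum n).trans hn)

section Maximal

variable {Ω : Type*} [MeasurableSpace Ω] {μ : Measure Ω} [IsProbabilityMeasure μ] {τ : Ω → Ω}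
  {B : Set Ω} {α : ℝ}

/-- The event that some ergodic average of length at most `N` of the indicator of `B` is at
least `α`. -/
def largeAverageEvent (τ : Ω → Ω) (B : Set Ω) (α : ℝ) (N : ℕ) : Set Ω :=
  {x | ∃ n, 1 ≤ n ∧ n ≤ N ∧ α * n ≤ ∑ i ∈ Finset.range n, B.indicator (fun _ => (1 : ℝ)) (τ^[i] x)}

theorem measurableSet_largeAverageEvent (hτ : Measurable τ) (hB : MeasurableSet B) (N : ℕ) :
    MeasurableSet (largeAverageEvent τ B α N) := by
  have : largeAverageEvent τ B α N = ⋃ n : ℕ, ⋃ (_ : 1 ≤ n ∧ n ≤ N),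
      {x | α * n ≤ ∑ i ∈ Finset.range n, B.indicator (fun _ => (1 : ℝ)) (τ^[i] x)} := by
    ext x
    simp [largeAverageEvent, and_assoc]
  rw [this]
  refine MeasurableSet.iUnion fun n => MeasurableSet.iUnion fun _ => ?_
  exact measurableSet_le measurable_const (Finset.measurable_fun_sum _ fun i _ =>
    (measurable_const.indicator hB).comp (hτ.iterate i))

/-- The maximal ergodic inequality for indicator functions. -/
theorem mul_measureReal_largeAverageEvent_le (hτ : MeasurePreserving τ μ μ)
    (hB : MeasurableSet B) (hα : 0 ≤ α) (N : ℕ) :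
    α * μ.real (largeAverageEvent τ B α N) ≤ μ.real B := by
  set E := largeAverageEvent τ B α N with hE
  have hEm : MeasurableSet E := measurableSet_largeAverageEvent hτ.measurable hB N
  have hint : ∀ (S : Set Ω), MeasurableSet S → ∀ i : ℕ,
      Integrable (fun x => S.indicator (fun _ => (1 : ℝ)) (τ^[i] x)) μ := fun S hS i =>
    (hτ.iterate i).integrable_comp_of_integrable ((integrable_const 1).indicator hS)
  have hval : ∀ (S : Set Ω), MeasurableSet S → ∀ i : ℕ,
      ∫ x, S.indicator (fun _ => (1 : ℝ)) (τ^[i] x) ∂μ = μ.real S := by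
    intro S hS i
    have h1 : (fun x => S.indicator (fun _ => (1 : ℝ)) (τ^[i] x)) =
        (τ^[i] ⁻¹' S).indicator (fun _ => (1 : ℝ)) := rfl
    rw [h1, integral_indicator_const _ ((hτ.iterate i).measurable hS), smul_eq_mul, mul_one,
      (hτ.iterate i).measureReal_preimage hS.nullMeasurableSet]
  have key : ∀ T : ℕ, α * (T * μ.real E) ≤ (T + N) * μ.real B := by
    intro T
    have hpt : ∀ x, α * ∑ k ∈ Finset.range T, E.indicator (fun _ => (1 : ℝ)) (τ^[k] x) ≤
        ∑ i ∈ Finset.range (T + N), B.indicator (fun _ => (1 : ℝ)) (τ^[i] x) := by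
      intro x
      refine mul_sum_range_le_sum_range hα T _ _ (fun i => indicator_nonneg (by simp) _)
        (fun k => indicator_le_self' (by simp) _) (fun k => ?_)
      by_cases hk : τ^[k] x ∈ E
      · obtain ⟨n, h1, h2, h3⟩ := hk
        refine Or.inr ⟨n, h1, h2, h3.trans_eq (Finset.sum_congr rfl fun i _ => ?_)⟩
        rw [add_comm k i, Function.iterate_add_apply]
      · exact Or.inl (indicator_of_notMem hk _).le
    have := integral_mono ((integrable_finsetSum _ fun i _ => hint E hEm i).const_mul α)
      (integrable_finsetSum _ fun i _ => hint B hB i) hpt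
    rw [integral_const_mul, integral_finsetSum _ fun i _ => hint E hEm i,
      integral_finsetSum _ fun i _ => hint B hB i] at this
    simpa [hval E hEm, hval B hB] using this
  by_contra! hlt
  -- For `T` this large, the boundary term `N * μ.real B` in `key` is beaten.
  obtain ⟨T, hT⟩ := exists_nat_gt (N * μ.real B / (α * μ.real E - μ.real B))
  rw [div_lt_iff₀ (by linarith)] at hT
  have := key T
  linarith

theorem measureReal_iUnion_largeAverageEvent_le (hτ : MeasurePreserving τ μ μ)
    (hB : MeasurableSet B) (hα : 0 < α) :
    μ.real (⋃ N, largeAverageEvent τ B α N) ≤ μ.real B / α := by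
  have hmono : Monotone (largeAverageEvent τ B α) := fun N N' h x ⟨n, h1, h2, h3⟩ =>
    ⟨n, h1, h2.trans h, h3⟩
  have hlim := (ENNReal.tendsto_toReal (measure_ne_top μ _)).comp
    (tendsto_measure_iUnion_atTop (μ := μ) hmono)
  refine le_of_tendsto' hlim fun N => ?_
  rw [le_div_iff₀ hα, mul_comm]
  exact mul_measureReal_largeAverageEvent_le hτ hB hα.le N

end Maximal

/-! ### Stationary potentials and sublinear gaps -/

namespace BUC

theorem measurable_eval (x : ℝ) : Measurable fun V : BUC => V.toFun x :=
  Measurable.of_comap_le (le_iSup (fun x : ℝ =>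
    MeasurableSpace.comap (fun V : BUC => V.toFun x) (borel ℝ)) x)

theorem measurable_translate (y : ℝ) : Measurable (translate y) := by
  refine measurable_iff_le_map.2 (iSup_le fun x => ?_)
  rintro _ ⟨t, ht, rfl⟩
  exact measurable_eval (x + y) ht

theorem translate_translate (x y : ℝ) (V : BUC) :
    translate x (translate y V) = translate (x + y) V := by
  simp only [translate, add_assoc]

theorem translate_zero (V : BUC) : translate 0 V = V := by
  simp only [translate, add_zero]

theorem image_translate (y : ℝ) (E : Set BUC) : translate y '' E = translate (-y) ⁻¹' E := by
  ext V
  constructor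
  · rintro ⟨W, hW, rfl⟩
    rwa [mem_preimage, translate_translate, neg_add_cancel, translate_zero]
  · intro hV
    exact ⟨_, hV, by rw [translate_translate, add_neg_cancel, translate_zero]⟩

theorem continuous (V : BUC) : Continuous V.toFun := V.uniformContinuous.continuous

theorem isBoundedUnder_le (V : BUC) : IsBoundedUnder (· ≤ ·) (ae volume) V.toFun := by
  obtain ⟨C, hC⟩ := V.bounded
  exact isBoundedUnder_of ⟨C, fun x => (abs_le.1 (hC x)).2⟩

theorem isCoboundedUnder_le (V : BUC) : IsCoboundedUnder (· ≤ ·) (ae volume) V.toFun := by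
  obtain ⟨C, hC⟩ := V.bounded
  exact IsBoundedUnder.isCoboundedUnder_le
    (isBoundedUnder_of ⟨-C, fun x => (abs_le.1 (hC x)).1⟩)

theorem nonpos_of_essSup_eq_zero {V : BUC} (h : essSup V.toFun volume = 0) (x : ℝ) :
    V.toFun x ≤ 0 := by
  have h1 := ae_le_essSup V.isBoundedUnder_le
  rw [h] at h1
  have h2 : IsOpen {x | 0 < V.toFun x} := isOpen_lt continuous_const V.continuous
  have h3 : {x | 0 < V.toFun x} = ∅ := by
    rw [← h2.measure_eq_zero_iff volume]
    simpa [ae_iff] using h1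
  by_contra! hx
  exact (h3 ▸ hx : x ∈ (∅ : Set ℝ))

theorem exists_lt_of_essSup_eq_zero {V : BUC} (h : essSup V.toFun volume = 0) {ε : ℝ}
    (hε : 0 < ε) : ∃ x, -ε < V.toFun x := by
  by_contra! hle
  have := essSup_le_of_ae_le (μ := volume) (-ε) (Eventually.of_forall hle) V.isCoboundedUnder_le
  linarith

end BUC

namespace BUC

/-- The event that the potential stays below `-ε` on `{σ s | 0 ≤ s ≤ M}`. -/
def lowRun (σ ε M : ℝ) : Set BUC :=
  {V | ∀ r : ℚ, 0 ≤ r → (r : ℝ) ≤ M → V.toFun (σ * r) ≤ -ε}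

/-- The event that the potential stays below `-ε` on the ray `{σ (t + s) | s ≥ 0}`. -/
def lowRay (σ ε t : ℝ) : Set BUC :=
  {V | ∀ r : ℚ, 0 ≤ r → V.toFun (σ * (r + t)) ≤ -ε}

/-- Rational times make the event a countable intersection; the same holds for `lowRay`. -/
theorem measurableSet_lowRun (σ ε M : ℝ) : MeasurableSet (lowRun σ ε M) := by
  simp only [lowRun, ofPred_forall]
  exact .iInter fun r => .iInter fun _ => .iInter fun _ =>
    measurableSet_le (measurable_eval _) measurable_const

theorem measurableSet_lowRay (σ ε t : ℝ) : MeasurableSet (lowRay σ ε t) := by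
  simp only [lowRay, ofPred_forall]
  exact .iInter fun r => .iInter fun _ =>
    measurableSet_le (measurable_eval _) measurable_const

theorem le_neg_of_forall_mem_lowRay {σ ε : ℝ} {V : BUC}
    (h : ∀ n : ℕ, V ∈ lowRay σ ε (-n)) (hσ : σ ≠ 0) (x : ℝ) : V.toFun x ≤ -ε := by
  have hrat : ∀ r : ℚ, V.toFun (σ * r) ≤ -ε := by
    intro r
    obtain ⟨n, hn⟩ := exists_nat_ge (-r)
    have := h n (r + n) (by linarith)
    simpa using this
  have hcont : Continuous fun s : ℝ => V.toFun (σ * s) := V.continuous.comp (by fun_prop)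
  have hclosed : IsClosed {s : ℝ | V.toFun (σ * s) ≤ -ε} := isClosed_le hcont continuous_const
  have hdense : DenseRange ((↑) : ℚ → ℝ) := Rat.denseRange_cast
  have := hdense.induction_on (p := fun s => V.toFun (σ * s) ≤ -ε) (x / σ) hclosed hrat
  rwa [mul_div_cancel₀ _ hσ] at this

variable {P : Measure BUC}

theorem measurePreserving_translate (h : ∀ E : Set BUC, MeasurableSet E →
    ∀ y : ℝ, P E = P (translate y '' E)) (y : ℝ) : MeasurePreserving (translate y) P P := by
  refine ⟨measurable_translate y, Measure.ext fun E hE => ?_⟩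
  rw [Measure.map_apply (measurable_translate y) hE, h E hE (-y), image_translate, neg_neg]

theorem iterate_translate_apply (σ : ℝ) (i : ℕ) (V : BUC) (x : ℝ) :
    ((translate σ)^[i] V).toFun x = V.toFun (x + i * σ) := by
  induction i generalizing V with
  | zero => simp
  | succ i ih =>
    rw [Function.iterate_succ_apply, ih]
    change V.toFun (x + i * σ + σ) = _
    push_cast
    ring_nf

variable [IsProbabilityMeasure P]

/-- The rays starting at `-n` give decreasing events of equal probability by stationarity; in the
intersection `V ≤ -ε` everywhere, which is null because `essSup V = 0`. -/
theorem measure_lowRay_zero (hP : IsStationaryErgodicLaw P) {σ ε : ℝ} (hσ : σ ≠ 0) (hε : 0 < ε) :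
    P (lowRay σ ε 0) = 0 := by
  obtain ⟨m, -, hsup, -⟩ := hP.normalized
  have hpre : ∀ n : ℕ, P (lowRay σ ε (-n)) = P (lowRay σ ε 0) := by
    intro n
    rw [← (measurePreserving_translate hP.stationary (-(σ * n))).measure_preimage
      (measurableSet_lowRay σ ε 0).nullMeasurableSet]
    congr 1
    ext V
    refine forall₂_congr fun r _ => ?_
    change _ ↔ V.toFun (σ * (r + 0) + -(σ * n)) ≤ -ε
    ring_nf
  have hanti : Antitone fun n : ℕ => lowRay σ ε (-n) := by
    intro n n' hn V hV r hr
    have := hV (r + (n' - n)) (by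
      have : (n : ℚ) ≤ n' := by exact_mod_cast hn
      linarith)
    push_cast at this
    rwa [show (r : ℝ) + (n' - n) + -n' = r + -n by ring] at this
  have hlim := tendsto_measure_iInter_atTop (μ := P) (s := fun n : ℕ => lowRay σ ε (-n))
    (fun n => (measurableSet_lowRay σ ε (-(n : ℝ))).nullMeasurableSet) hanti
    ⟨0, measure_ne_top _ _⟩
  have hnull : P (⋂ n : ℕ, lowRay σ ε (-n)) = 0 := by
    refine measure_mono_null (fun V hV => ?_) (ae_iff.1 hsup)
    intro h0
    obtain ⟨x, hx⟩ := exists_lt_of_essSup_eq_zero h0 hε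
    exact absurd (le_neg_of_forall_mem_lowRay (mem_iInter.1 hV) hσ x) (not_le.2 hx)
  rw [hnull] at hlim
  refine tendsto_nhds_unique ?_ hlim
  simp only [Function.comp_def, hpre]
  exact tendsto_const_nhds

theorem tendsto_measureReal_lowRun (hP : IsStationaryErgodicLaw P) {σ ε : ℝ} (hσ : σ ≠ 0)
    (hε : 0 < ε) : Tendsto (fun M : ℕ => P.real (lowRun σ ε M)) atTop (𝓝 0) := by
  have hanti : Antitone fun M : ℕ => lowRun σ ε M := by
    intro M M' hM V hV r hr hrM
    exact hV r hr (hrM.trans (by exact_mod_cast hM))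
  have hlim := tendsto_measure_iInter_atTop (μ := P) (s := fun M : ℕ => lowRun σ ε M)
    (fun M => (measurableSet_lowRun σ ε (M : ℝ)).nullMeasurableSet) hanti
    ⟨0, measure_ne_top _ _⟩
  have hnull : P (⋂ M : ℕ, lowRun σ ε M) = 0 := by
    refine measure_mono_null ?_ (measure_lowRay_zero hP hσ hε)
    intro V hV r hr
    rw [add_zero]
    obtain ⟨M, hM⟩ := exists_nat_ge (r : ℝ)
    exact mem_iInter.1 hV M r hr hM
  rw [hnull] at hlim
  exact (ENNReal.tendsto_toReal ENNReal.zero_ne_top).comp hlim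

/-- A long low run far out forces a large ergodic average of the indicator of `lowRun`. -/
theorem mem_iUnion_largeAverageEvent {σ ε δ : ℝ} (hδ : 0 < δ) {V : BUC} {M : ℕ} {N y : ℝ}
    (hN : 2 * (M + 2) / δ ≤ N) (hy0 : 0 ≤ y) (hyN : y ≤ N)
    (hV : ∀ z ∈ Icc y (y + δ * N), V.toFun (σ * z) ≤ -ε) :
    V ∈ ⋃ n, largeAverageEvent (translate σ) (lowRun σ ε M) (δ / (2 * (1 + δ))) n := by
  rw [div_le_iff₀ hδ] at hN
  have hJ0 : 0 ≤ δ * N - M - 1 := by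
    have : (0 : ℝ) ≤ M := M.cast_nonneg
    linarith
  have hJle := Nat.floor_le hJ0
  have hJlt := Nat.lt_floor_add_one (δ * N - M - 1)
  have hkle := Nat.le_ceil y
  have hklt := Nat.ceil_lt_add_one hy0
  -- Runs of length `M` started at `k, …, k + J - 1` stay in the low stretch. The bound on `N` gives
  -- `J ≥ δ * N / 2`, while `k + J ≤ (1 + δ) * N`; their ratio is the threshold.
  set J := ⌊δ * N - M - 1⌋₊
  set k := ⌈y⌉₊
  have hM0 : (0 : ℝ) ≤ M := M.cast_nonneg
  have hJ1 : 1 ≤ J := by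
    have : (0 : ℝ) < J := by linarith
    exact_mod_cast this
  have hmem : ∀ i ∈ Finset.range J, (translate σ)^[k + i] V ∈ lowRun σ ε M := by
    intro i hi r hr hrM
    have hiJ : (i : ℝ) + 1 ≤ J := by exact_mod_cast Finset.mem_range.1 hi
    have hr' : (0 : ℝ) ≤ r := by exact_mod_cast hr
    have hi0 : (0 : ℝ) ≤ i := i.cast_nonneg
    rw [iterate_translate_apply, show σ * (r : ℝ) + ((k + i : ℕ) : ℝ) * σ =
      σ * (r + (k + i)) by push_cast; ring]
    exact hV _ ⟨by linarith, by linarith⟩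
  refine mem_iUnion.2 ⟨k + J, k + J, by lia, le_rfl, ?_⟩
  calc δ / (2 * (1 + δ)) * ((k + J : ℕ) : ℝ) ≤ δ / (2 * (1 + δ)) * ((1 + δ) * N) := by
        push_cast
        gcongr
        linarith
    _ = δ * N / 2 := by field_simp
    _ ≤ J := by linarith
    _ = ∑ i ∈ Finset.range J,
          (lowRun σ ε M).indicator (fun _ => (1 : ℝ)) ((translate σ)^[k + i] V) := by
        rw [Finset.sum_congr rfl fun i hi => indicator_of_mem (hmem i hi) _]
        simp
    _ ≤ _ := by
        rw [Finset.sum_range_add]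
        exact le_add_of_nonneg_left (Finset.sum_nonneg fun i _ => indicator_nonneg (by simp) _)

/-- The exceptional event lies in the large-average event of `lowRun σ ε M` for every `M`, with a
threshold independent of `M`, and `P.real (lowRun σ ε M)` tends to `0`. -/
theorem ae_exists_forall_exists_lt (hP : IsStationaryErgodicLaw P) {σ ε δ : ℝ} (hσ : σ ≠ 0)
    (hε : 0 < ε) (hδ : 0 < δ) :
    ∀ᵐ V ∂P, ∃ N₀ : ℝ, ∀ N, N₀ ≤ N → ∀ y, 0 ≤ y → y ≤ N →
      ∃ z ∈ Icc y (y + δ * N), -ε < V.toFun (σ * z) := by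
  rw [ae_iff]
  set F := {V : BUC | ¬∃ N₀ : ℝ, ∀ N, N₀ ≤ N → ∀ y, 0 ≤ y → y ≤ N →
      ∃ z ∈ Icc y (y + δ * N), -ε < V.toFun (σ * z)}
  have hα : 0 < δ / (2 * (1 + δ)) := by positivity
  have hle : ∀ M : ℕ, P.real F ≤ P.real (lowRun σ ε M) / (δ / (2 * (1 + δ))) := by
    intro M
    refine le_trans (measureReal_mono fun V hV => ?_)
      (measureReal_iUnion_largeAverageEvent_le (measurePreserving_translate hP.stationary σ)
        (measurableSet_lowRun σ ε M) hα)
    have hV' := not_exists.1 hV (2 * (M + 2) / δ)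
    push Not at hV'
    obtain ⟨N, hN, y, hy0, hyN, hz⟩ := hV'
    exact mem_iUnion_largeAverageEvent hδ hN hy0 hyN hz
  have h0 : P.real F ≤ 0 := by
    have := (tendsto_measureReal_lowRun hP hσ hε).div_const (δ / (2 * (1 + δ)))
    rw [zero_div] at this
    exact ge_of_tendsto' this hle
  exact (measureReal_eq_zero_iff).1 (le_antisymm h0 measureReal_nonneg)

/-- Countably many tolerances `1 / (n + 1)` suffice, and `σ = 1`, `σ = -1` cover the two half-lines.
-/
theorem ae_hasSublinearGaps (hP : IsStationaryErgodicLaw P) :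
    ∀ᵐ V ∂P, HasSublinearGaps V.toFun := by
  have hpos : ∀ n : ℕ, (0 : ℝ) < 1 / (n + 1) := fun n => Nat.one_div_pos_of_nat
  have hall : ∀ σ : ℝ, σ ≠ 0 → ∀ᵐ V ∂P, ∀ n : ℕ, ∃ N₀ : ℝ, ∀ N, N₀ ≤ N → ∀ y, 0 ≤ y → y ≤ N →
      ∃ z ∈ Icc y (y + 1 / ((n : ℝ) + 1) * N), -(1 / ((n : ℝ) + 1)) < V.toFun (σ * z) := fun σ hσ =>
    ae_all_iff.2 fun n => ae_exists_forall_exists_lt hP hσ (hpos n) (hpos n)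
  filter_upwards [hall 1 one_ne_zero, hall (-1) (by norm_num)] with V h1 h2 ε hε δ hδ
  obtain ⟨n, hn⟩ := exists_nat_one_div_lt (lt_min hε hδ)
  have hnε : 1 / ((n : ℝ) + 1) < ε := hn.trans_le (min_le_left _ _)
  have hnδ : 1 / ((n : ℝ) + 1) < δ := hn.trans_le (min_le_right _ _)
  obtain ⟨N₁, hN₁⟩ := h1 n
  obtain ⟨N₂, hN₂⟩ := h2 n
  refine ⟨max N₁ N₂, fun N hN y hy => ?_⟩
  have hN0 : 0 ≤ N := (abs_nonneg y).trans hy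
  have hmul : 1 / ((n : ℝ) + 1) * N ≤ δ * N := by gcongr
  rcases le_total 0 y with hy0 | hy0
  · obtain ⟨z, hz, hVz⟩ := hN₁ N ((le_max_left _ _).trans hN) y hy0
      (by rwa [abs_of_nonneg hy0] at hy)
    rw [one_mul] at hVz
    refine ⟨z, ?_, by linarith⟩
    rw [abs_of_nonneg (by linarith [hz.1])]
    linarith [hz.2]
  · obtain ⟨z, hz, hVz⟩ := hN₂ N ((le_max_right _ _).trans hN) (-y) (by linarith)
      (by rwa [abs_of_nonpos hy0] at hy)
    rw [neg_one_mul] at hVz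
    refine ⟨-z, ?_, by linarith⟩
    rw [abs_of_nonpos (by linarith [hz.1])]
    linarith [hz.2]

end BUC

/-! ### Conclusion -/

theorem mainTheorem8 (P : Measure BUC) [IsProbabilityMeasure P] (H : ℝ → ℝ)
    (hH : IsNormalizedHamiltonian H)
    (hright : HasFiniteWellsRight H)
    (hleft : HasFiniteWellsLeft H)
    (hV : ∀ᵐ V ∂P, IsRegularPotential V.toFun)
    (q : ℝ)
    (hq : IsRegularlyHomogenizableAt P H q)
    (hq0 : effectiveHamiltonian P H q = 0) :
    ∀ p ∈ segment ℝ 0 q,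
      IsRegularlyHomogenizableAt P H p ∧ effectiveHamiltonian P H p = 0 := by
  intro p hp
  obtain ⟨K, hK⟩ := hH.lipschitz
  have hpos : ∀ s, s ≠ 0 → 0 < H s := by
    intro s hs
    rcases lt_or_gt_of_ne hs with h | h
    · simpa using hleft.reflect.pos (by simpa using hH.zero) (neg_pos.2 h)
    · exact hright.pos hH.zero h
  have hqval : HasEffectiveValue P H q 0 := by
    obtain ⟨c, hc⟩ := hq.exists_value
    rwa [← hq0, effectiveHamiltonian_eq hc]
  have hexists : ∀ (V : BUC) (p l : ℝ), 0 < l → ∃ v, IsCellSolution H V.toFun l p v :=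
    fun V p l hl =>
      exists_isCellSolution p hK.continuous hH.nonneg hH.coercive V.continuous V.bounded hl
  obtain ⟨m, -, hsup, -⟩ := hq.law.normalized
  have hnull : ∀ᵐ V ∂P, ∀ u : ℝ → ℝ → ℝ,
      (∀ l : ℝ, 0 < l → IsCellSolution H V.toFun l q (u l)) → IsMacroscopicallyNull u := by
    -- The null set may depend on `R`; the radii `n + 1` give a single null set valid for all `R`.
    have hall : ∀ᵐ V ∂P, ∀ n : ℕ, ∀ u : ℝ → ℝ → ℝ,
        (∀ l : ℝ, 0 < l → IsCellSolution H V.toFun l q (u l)) →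
        Tendsto (fun l : ℝ =>
          sSup ((fun y => |l * u l y + 0|) '' Icc (-(((n : ℝ) + 1) / l)) (((n : ℝ) + 1) / l)))
          (𝓝[>] 0) (𝓝 0) :=
      ae_all_iff.2 fun n => hqval.2 (n + 1) (by positivity)
    filter_upwards [hall] with V hV u hu R hR κ hκ
    obtain ⟨n, hn⟩ := exists_nat_ge R
    have h1 := (tendsto_sSup_iff_eventually (fun l hl => (hu l hl).continuous)
      (by positivity : (0 : ℝ) < n + 1)).1 (hV n u hu) κ hκ
    filter_upwards [h1, self_mem_nhdsWithin] with l hl hl0 y hy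
    have hl0 : 0 < l := hl0
    have h2 : R / l ≤ (n + 1) / l := by gcongr; linarith
    exact hl y ⟨by linarith [hy.1], hy.2.trans h2⟩
  have hpval : HasEffectiveValue P H p 0 := by
    refine ⟨Eventually.of_forall fun V l hl => ?_, fun R hR => ?_⟩
    · obtain ⟨v, hv⟩ := hexists V p l hl
      exact ⟨v, hv, fun w hw => hw.unique hK V.continuous hl hv⟩
    · filter_upwards [hnull, hsup, BUC.ae_hasSublinearGaps hq.law] with V hVnull hVsup hVgaps v hv
      -- For `l ≤ 0` the choice is the irrelevant default `0`.
      have hex : ∀ l : ℝ, ∃ u : ℝ → ℝ, 0 < l → IsCellSolution H V.toFun l q u := fun l => by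
        by_cases hl : 0 < l
        · exact (hexists V q l hl).imp fun u hu _ => hu
        · exact ⟨0, fun h => absurd h hl⟩
      choose u hu using hex
      exact (tendsto_sSup_iff_eventually (fun l hl => (hv l hl).continuous) hR).2
        (IsMacroscopicallyNull.of_mem_segment hK hH.coercive hH.zero hpos V.continuous V.bounded
          (BUC.nonpos_of_essSup_eq_zero hVsup) hVgaps hp hu hv (hVnull u hu) R hR)
  exact ⟨⟨hq.law, hq.continuous, hq.coercive, 0, hpval⟩, effectiveHamiltonian_eq hpval⟩
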